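/- Consider $K$ servers in continuous time. Server $j$ starts with $Q_j(0)\in\mathbb N$ jobs, receives $A_j(t)$ jobs during $(0,t]$ ($A_j$ is a counting process: nondecreasing, right-continuous, $\mathbb N$-valued, $A_j(0)=0$), and is a non-idling first-in-first-out single-server queue; $Q_j(t)$ is its queue length at time $t$, including the job in service. Let $\mu_j>0$. MSR emulation with ET-$x$ communication. Put $t_j^0=0$. At time $t_j^m$ server $j$ reports $Q_j(t_j^m)$ to the load balancer, which then emulates a FIFO queue that starts with $Q_j(t_j^m)$ jobs, is fed by the actual arrivals to server $j$ after $t_j^m$, and in which every job (initial or arriving) has the deterministic service time $1/\mu_j$. The approximation $\tilde Q_j(t)$ is the length of this emulated queue for $t_j^m\le t<t_j^{m+1}$. The next message is sent at the first time $t_j^{m+1}>t_j^m$ at which the absolute difference between $Q_j$ and the emulated queue is equal to $x$ ($t_j^{m+1}=\infty$ if this never happens). Fix $x\in\{3,4,\dots\}$ and a server $i$, and assume: 1. the service times $V_i^1,V_i^2,\dots$ of the successive jobs processed by server $i$ are i.i.d. $\mathrm{Exp}(\mu_i)$; those of the other servers are arbitrary random variables that are almost surely strictly positive; 2. the arrivals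 to server $i$ are non-anticipating: there is a $\sigma$-algebra $\mathcal E$, independent of $(V_i^l)_{l\ge1}$, such that $Q_i(0)$ is $\mathcal E$-measurable and such that, for all $t\ge0$ and $n\in\mathbb N$, $A_i(t)$ agrees almost surely on the event that exactly $n$ jobs have been completed by server $i$ during $[0,t]$ with a $\sigma(\mathcal E,V_i^1,\dots,V_i^n)$-measurable random variable. Nothing else is assumed about the arrivals or about the way jobs are routed to the servers. Then: (a) almost surely, $AQ(t):=\max_j|Q_j(t)-\tilde Q_j(t)|\le x-1$ for all $t\ge0$; (b) for every $m\ge0$ with $\mathbb P(t_i^m<\infty)>0$, the duration $\tau_i=t_i^{m+1}-t_i^m\in[0,\infty]$ of the interval between consecutive messages of server $i$ satisfies $$\mathbb E\big[\tau_i\,\big|\,t_i^m<\infty\big]\ \ge\ \frac{(x/2-1)^2}{\mu_i}.$$ -/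

import Mathlib

open MeasureTheory ProbabilityTheory Set
open scoped ENNReal NNReal

noncomputable section

namespace CARE

/-- A path of a counting process: no arrivals at time `0`, nondecreasing, right-continuous,
finitely many arrivals in finite time. Several arrivals at the same instant are allowed. -/
structure IsCountingPath (a : ℝ≥0 → ℕ) : Prop where
  zero : a 0 = 0
  mono : Monotone a
  rightCts : ∀ t, ContinuousWithinAt a (Ici t) t

/-! ### The single server FIFO queue

A queue is fed by `q` jobs present at time `0` and by the arrivals counted by `a`. The jobs are
labelled `0, 1, 2, …` in the order of arrival (the initial ones first), and job `l` has service
time requirement `v l`. -/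

/-- The time at which job `l` joins the queue (`∞` if it never does, `0` for the initial jobs). -/
def arrivalEpoch (q : ℕ) (a : ℝ≥0 → ℕ) (l : ℕ) : ℝ≥0∞ :=
  ⨅ (t : ℝ≥0) (_ : l < q + a t), (t : ℝ≥0∞)

/-- The time at which job `l` is completed by a non-idling FIFO server: its service starts as soon
as it is present and all the earlier jobs are completed, and lasts for `v l`. -/
def completionTime (q : ℕ) (a : ℝ≥0 → ℕ) (v : ℕ → ℝ) : ℕ → ℝ≥0∞
  | 0 => arrivalEpoch q a 0 + ENNReal.ofReal (v 0)
  | l + 1 => max (arrivalEpoch q a (l + 1)) (completionTime q a v l) + ENNReal.ofReal (v (l + 1))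

open Classical in
/-- The number of jobs completed during `[0, t]`. Only the `q + a t` jobs that have joined the
queue by time `t` can be among them. -/
def departures (q : ℕ) (a : ℝ≥0 → ℕ) (v : ℕ → ℝ) (t : ℝ≥0) : ℕ :=
  ((Finset.range (q + a t)).filter fun l => completionTime q a v l ≤ t).card

/-- The number of jobs in the queue at time `t`, including the one in service. -/
def queueLength (q : ℕ) (a : ℝ≥0 → ℕ) (v : ℕ → ℝ) (t : ℝ≥0) : ℕ :=
  q + a t - departures q a v t

/-- The subtraction in `queueLength` never truncates. -/
theorem departures_le (q : ℕ) (a : ℝ≥0 → ℕ) (v : ℕ → ℝ) (t : ℝ≥0) :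
    departures q a v t ≤ q + a t := by
  classical
  unfold departures
  refine (Finset.card_filter_le _ _).trans ?_
  simp

/-- Flow equation: initial jobs and arrivals are either still queued or have departed. -/
theorem queueLength_add_departures (q : ℕ) (a : ℝ≥0 → ℕ) (v : ℕ → ℝ) (t : ℝ≥0) :
    queueLength q a v t + departures q a v t = q + a t :=
  Nat.sub_add_cancel (departures_le q a v t)

/-! ### MSR emulation and the ET-x communication pattern at one server

`r` is the service rate known to the load balancer, i.e. `1 / r` is the mean requirement. -/

/-- The value at time `t` of the MSR emulation started at time `s ≤ t`: a FIFO queue with initial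
condition the actual queue length at time `s`, fed by the actual arrivals during `(s, t]`, in which
every job is assigned the requirement `1 / r`. -/
def msrEmulation (r : ℝ) (q : ℕ) (a : ℝ≥0 → ℕ) (v : ℕ → ℝ) (s t : ℝ≥0) : ℕ :=
  queueLength (queueLength q a v s) (fun u => a (s + u) - a s) (fun _ => 1 / r) (t - s)

/-- The absolute difference at time `t` between the actual queue length and the MSR emulation
started at time `s ≤ t`. -/
def emulationError (r : ℝ) (q : ℕ) (a : ℝ≥0 → ℕ) (v : ℕ → ℝ) (s t : ℝ≥0) : ℕ :=
  ((queueLength q a v t : ℤ) - (msrEmulation r q a v s t : ℤ)).natAbs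

/-- The messaging times under ET-`x` with MSR: `messageTime 0 = 0`, and message `m + 1` is sent at
the first time at which the error of the emulation started at message `m` is equal to `x`.
The value is `∞` if the message is never sent. -/
def messageTime (x : ℕ) (r : ℝ) (q : ℕ) (a : ℝ≥0 → ℕ) (v : ℕ → ℝ) : ℕ → ℝ≥0∞
  | 0 => 0
  | m + 1 => ⨅ (t : ℝ≥0) (_ : messageTime x r q a v m ≤ t ∧
      emulationError r q a v (messageTime x r q a v m).toNNReal t = x), (t : ℝ≥0∞)

/-- The number of messages sent after time zero and up to time `t`. -/
def messageCount (x : ℕ) (r : ℝ) (q : ℕ) (a : ℝ≥0 → ℕ) (v : ℕ → ℝ) (t : ℝ≥0) : ℕ :=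
  sSup {m : ℕ | messageTime x r q a v m ≤ t}

/-- The load balancer's approximation of the queue length at time `t`: the current value of the
emulation that was started at the last messaging time. -/
def approxQueue (x : ℕ) (r : ℝ) (q : ℕ) (a : ℝ≥0 → ℕ) (v : ℕ → ℝ) (t : ℝ≥0) : ℕ :=
  msrEmulation r q a v (messageTime x r q a v (messageCount x r q a v t)).toNNReal t

/-- The approximation error of the server at time `t`. -/
def approxError (x : ℕ) (r : ℝ) (q : ℕ) (a : ℝ≥0 → ℕ) (v : ℕ → ℝ) (t : ℝ≥0) : ℕ :=
  ((queueLength q a v t : ℤ) - (approxQueue x r q a v t : ℤ)).natAbs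

/-- The approximation quality at time `t` in a system of `K` servers: the largest approximation
error among the servers. -/
def approxQuality {K : ℕ} (x : ℕ) (r : Fin K → ℝ) (q : Fin K → ℕ) (a : Fin K → ℝ≥0 → ℕ)
    (v : Fin K → ℕ → ℝ) (t : ℝ≥0) : ℕ :=
  Finset.univ.sup fun j => approxError x (r j) (q j) (a j) (v j) t

/-! ### Causality -/

/-- The information carried by the exogenous σ-algebra `𝓔` and by the service time requirements
of the first `n` jobs of a server. -/
abbrev infoUpTo {Ω : Type*} (𝓔 : MeasurableSpace Ω) (V : ℕ → Ω → ℝ) (n : ℕ) : MeasurableSpace Ω :=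
  𝓔 ⊔ ⨆ (l : ℕ) (_ : l < n), MeasurableSpace.comap (V l) inferInstance

/-- The arrivals to a server do not look into the future of its service process: if `n` jobs have
been completed by time `t`, then the number of arrivals up to time `t` is a function of the
exogenous information and of the requirements of these `n` jobs. -/
def NonAnticipating {Ω : Type*} {mΩ : MeasurableSpace Ω} (P : Measure Ω) (𝓔 : MeasurableSpace Ω)
    (q : Ω → ℕ) (A : ℝ≥0 → Ω → ℕ) (V : ℕ → Ω → ℝ) : Prop :=
  ∀ (t : ℝ≥0) (n : ℕ), ∃ f : Ω → ℕ, Measurable[infoUpTo 𝓔 V n] f ∧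
    ∀ᵐ ω ∂P, departures (q ω) (fun s => A s ω) (fun l => V l ω) t = n → A t ω = f ω

end CARE

end

noncomputable section

namespace CARE

/-! Arrivals cancel in the error. If `D` counts departures from the server and `N` those from the
emulation started at the message time `s`, the error at `t` is `|N + D(s) - D(t)|`
(`emulationError_eq`). Requirements are positive, so each of the two departure processes has unit
jumps, and the error cannot reach or pass `x` without being equal to `x` at some time on the way
(`exists_emulationError_eq`). The infimum defining a message time is attained by right-continuity,
and messages do not accumulate (`bddAbove_messageTime_le`). Hence at every time there is a last
message, and an error of at least `x` would contradict that it is the last. This is (a).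

For (b), let `y` be the number of completions since `s` minus `r` times the work performed since
`s`. From `s` on, the server and the emulation are FIFO queues with the same joining epochs; only
the requirements differ. A FIFO completion time is a maximum over `j` of the epoch of job `j` plus
the requirements from job `j` on. Comparing the two maxima shows that an error of `x` at time `t`
forces `|y|` to have reached `lam = x/2 - 1` by then (`IsResidual.stoppedWalk_bounds`).

In busy time, `y` is a compensated Poisson process: stopped at level `lam`, its second moment is `r`
times the expected work, which is at most `r` times the expected duration
(`lintegral_stoppedWalk_sq`, `IsResidual.sum_walkWork_le`). As `y ^ 2 ≥ lam ^ 2` at the end, the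
bound follows.

The delicate point is causality, since `s` is random and arrivals may depend on past services. The
filtration is indexed by jobs, `𝓕 l` being the information available before the requirement of job
`l` is revealed. Message times are stopping times for the induced `history`, so the service that job
`l` has received by the message is given by an `𝓕 l`-measurable variable, as far as the residual is
concerned (`IsCausal.exists_residual`). Its requirement is independent of `𝓕 l`, and the exponential
law does the rest. -/

theorem exists_coe_eq_of_ne_top {b : ℝ≥0∞} (h : b ≠ ∞) : ∃ s : ℝ≥0, (s : ℝ≥0∞) = b :=
  ⟨b.toNNReal, ENNReal.coe_toNNReal h⟩

/-! ### The FIFO recursion -/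

/-- Completion times of a FIFO server when job `l` joins at time `e l` and requires `w l`. -/
def lindley (e w : ℕ → ℝ≥0∞) : ℕ → ℝ≥0∞
  | 0 => e 0 + w 0
  | l + 1 => max (e (l + 1)) (lindley e w l) + w (l + 1)

section Lindley

variable {e w : ℕ → ℝ≥0∞}

theorem lindley_mono : Monotone (lindley e w) :=
  monotone_nat_of_le_succ fun _ => (le_max_right _ _).trans le_self_add

theorem le_lindley {j l : ℕ} (h : j ≤ l) :
    e j + ∑ k ∈ Finset.Icc j l, w k ≤ lindley e w l := by
  induction l, h using Nat.le_induction with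
  | base =>
    cases j with
    | zero => simp [lindley]
    | succ j => simpa [lindley] using add_le_add_left (le_max_left _ _) _
  | succ l h ih =>
    rw [Finset.sum_Icc_succ_top (by omega), ← add_assoc]
    exact add_le_add_left (ih.trans (le_max_right _ _)) _

/-- The index `j` is the job that opens the busy period containing job `l`: from its arrival on, the
server never idles until job `l` is completed. -/
theorem exists_lindley_eq (e w : ℕ → ℝ≥0∞) (l : ℕ) :
    ∃ j ≤ l, lindley e w l = e j + ∑ k ∈ Finset.Icc j l, w k := by
  induction l with
  | zero => exact ⟨0, le_rfl, by simp [lindley]⟩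
  | succ l ih =>
    rcases le_total (lindley e w l) (e (l + 1)) with h | h
    · exact ⟨l + 1, le_rfl, by simp [lindley, max_eq_left h]⟩
    · obtain ⟨j, hj, hl⟩ := ih
      refine ⟨j, by omega, ?_⟩
      rw [lindley, max_eq_right h, hl, Finset.sum_Icc_succ_top (by omega), add_assoc]

theorem lindley_le_iff {l : ℕ} {t : ℝ≥0∞} :
    lindley e w l ≤ t ↔ ∀ j ≤ l, e j + ∑ k ∈ Finset.Icc j l, w k ≤ t := by
  refine ⟨fun h j hj => (le_lindley hj).trans h, fun h => ?_⟩
  obtain ⟨j, hj, hl⟩ := exists_lindley_eq e w l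
  exact hl ▸ h j hj

theorem lindley_lt_lindley_succ {l : ℕ} (hw : 0 < w (l + 1)) (h : lindley e w l ≠ ∞) :
    lindley e w l < lindley e w (l + 1) :=
  calc lindley e w l < lindley e w l + w (l + 1) := ENNReal.lt_add_right h hw.ne'
    _ ≤ _ := add_le_add_left (le_max_right _ _) _

theorem lindley_add_const (c : ℝ≥0∞) (l : ℕ) :
    c + lindley e w l = lindley (fun j => c + e j) w l := by
  induction l with
  | zero => simp [lindley, add_assoc]
  | succ l ih =>
    rw [lindley, lindley, ← ih, ← add_assoc]
    congr 1
    exact Monotone.map_max fun x y h => by gcongr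

end Lindley

/-! ### Arrival epochs, completion times and departures -/

section Queue

variable {q : ℕ} {a : ℝ≥0 → ℕ} {v : ℕ → ℝ}

theorem IsCountingPath.eventually_eq (ha : IsCountingPath a) (t : ℝ≥0) :
    ∃ u > t, ∀ w, t ≤ w → w < u → a w = a t := by
  have h := ha.rightCts t
  rw [ContinuousWithinAt, nhds_discrete, Filter.tendsto_pure] at h
  obtain ⟨u, hu, hs⟩ := mem_nhdsGE_iff_exists_Ico_subset.1 h
  exact ⟨u, hu, fun w h1 h2 => hs ⟨h1, h2⟩⟩

/-- Right-continuity makes the infimum defining the epoch attained, so that epochs and counts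
determine each other. -/
theorem IsCountingPath.arrivalEpoch_le_iff (ha : IsCountingPath a) {l : ℕ} {t : ℝ≥0} :
    arrivalEpoch q a l ≤ t ↔ l < q + a t := by
  refine ⟨fun h => ?_, fun h => iInf₂_le t h⟩
  by_contra! hl
  obtain ⟨u, hu, hs⟩ := ha.eventually_eq t
  have : (u : ℝ≥0∞) ≤ arrivalEpoch q a l := by
    refine le_iInf₂ fun w hw => ?_
    by_contra! hwu
    have hwu : w < u := by exact_mod_cast hwu
    rcases le_total t w with h1 | h1
    · rw [hs w h1 hwu] at hw; omega
    · have := ha.mono h1; omega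
  exact absurd (this.trans h) (by exact_mod_cast hu.not_ge)

theorem IsCountingPath.shift (ha : IsCountingPath a) (s : ℝ≥0) :
    IsCountingPath fun u => a (s + u) - a s where
  zero := by simp
  mono := fun u w h => Nat.sub_le_sub_right (ha.mono (by gcongr)) _
  rightCts := fun t => by
    have h1 : ContinuousWithinAt (fun u => a (s + u)) (Ici t) t := by
      refine ContinuousWithinAt.comp (t := Ici (s + t)) (ha.rightCts (s + t))
        (by fun_prop) fun u hu => ?_
      simp only [mem_Ici] at hu ⊢
      gcongr
    have h2 : Continuous fun n : ℕ => n - a s := continuous_of_discreteTopology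
    exact h2.continuousAt.comp_continuousWithinAt h1

theorem completionTime_eq_lindley (l : ℕ) :
    completionTime q a v l = lindley (arrivalEpoch q a) (fun k => ENNReal.ofReal (v k)) l := by
  induction l with
  | zero => rfl
  | succ l ih => rw [completionTime, lindley, ih]

theorem completionTime_mono : Monotone (completionTime q a v) := by
  intro k l h
  simpa only [completionTime_eq_lindley] using lindley_mono h

/-- The time at which the predecessor of job `l` is completed (`0` for the first job). -/
def prevCompletion (q : ℕ) (a : ℝ≥0 → ℕ) (v : ℕ → ℝ) : ℕ → ℝ≥0∞
  | 0 => 0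
  | l + 1 => completionTime q a v l

/-- The time at which the service of job `l` starts. -/
def serviceStart (q : ℕ) (a : ℝ≥0 → ℕ) (v : ℕ → ℝ) (l : ℕ) : ℝ≥0∞ :=
  max (arrivalEpoch q a l) (prevCompletion q a v l)

theorem completionTime_eq_serviceStart_add (l : ℕ) :
    completionTime q a v l = serviceStart q a v l + ENNReal.ofReal (v l) := by
  cases l with
  | zero => simp [completionTime, serviceStart, prevCompletion]
  | succ l => rfl

theorem arrivalEpoch_le_completionTime (l : ℕ) :
    arrivalEpoch q a l ≤ completionTime q a v l :=
  (le_max_left _ _).trans ((completionTime_eq_serviceStart_add l).symm ▸ le_self_add)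

theorem lt_departures_iff (ha : IsCountingPath a) {l : ℕ} {t : ℝ≥0} :
    l < departures q a v t ↔ completionTime q a v l ≤ t := by
  classical
  constructor
  · intro h
    by_contra! hl
    refine h.not_ge ?_
    refine (Finset.card_le_card (t := Finset.range l) fun k hk => ?_).trans (by simp)
    simp only [Finset.mem_filter, Finset.mem_range] at hk ⊢
    by_contra! hkl
    exact absurd hk.2 (not_le.2 (hl.trans_le (completionTime_mono hkl)))
  · intro h
    have : (Finset.range (l + 1)).card ≤ departures q a v t := by
      refine Finset.card_le_card fun k hk => ?_
      have hk : k ≤ l := by simpa [Nat.lt_succ_iff] using hk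
      have hkt := (completionTime_mono hk).trans h
      simp only [Finset.mem_filter, Finset.mem_range]
      exact ⟨ha.arrivalEpoch_le_iff.1 ((arrivalEpoch_le_completionTime k).trans hkt), hkt⟩
    simpa using this

theorem le_departures_iff (ha : IsCountingPath a) {l : ℕ} {t : ℝ≥0} :
    l ≤ departures q a v t ↔ prevCompletion q a v l ≤ t := by
  cases l with
  | zero => simp [prevCompletion]
  | succ l => exact lt_departures_iff ha

theorem departures_eq_iff (ha : IsCountingPath a) {l : ℕ} {t : ℝ≥0} :
    departures q a v t = l ↔ prevCompletion q a v l ≤ t ∧ t < completionTime q a v l := by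
  rw [← le_departures_iff ha, ← not_le, ← lt_departures_iff ha]
  omega

theorem departures_mono (ha : IsCountingPath a) : Monotone (departures q a v) := by
  intro s t h
  rw [le_departures_iff ha]
  exact ((le_departures_iff ha).1 le_rfl).trans (by exact_mod_cast h)

theorem departures_eventually_eq (ha : IsCountingPath a) (t : ℝ≥0) :
    ∃ u > t, ∀ w, t ≤ w → w < u → departures q a v w = departures q a v t := by
  have h := ((departures_eq_iff (q := q) (v := v) ha).1 (rfl : departures q a v t = _))
  obtain ⟨u, htu, hu⟩ := ENNReal.lt_iff_exists_nnreal_btwn.1 h.2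
  refine ⟨u, by exact_mod_cast htu, fun w h1 h2 => (departures_eq_iff ha).2 ⟨?_, ?_⟩⟩
  · exact h.1.trans (by exact_mod_cast h1)
  · exact lt_trans (by exact_mod_cast h2) hu

end Queue

/-! ### The emulation -/

section Emulation

variable {q : ℕ} {a : ℝ≥0 → ℕ} {v : ℕ → ℝ} {r : ℝ}

/-- The number of departures from the emulated queue started at time `s`, until time `t`. -/
def emulatedDepartures (r : ℝ) (q : ℕ) (a : ℝ≥0 → ℕ) (v : ℕ → ℝ) (s t : ℝ≥0) : ℕ :=
  departures (queueLength q a v s) (fun u => a (s + u) - a s) (fun _ => 1 / r) (t - s)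

/-- The time at which job `l` joins the emulated queue started at time `s`, with jobs labelled from
the one at the head of the queue at time `s`. -/
def emulatedEpoch (q : ℕ) (a : ℝ≥0 → ℕ) (v : ℕ → ℝ) (s : ℝ≥0) (l : ℕ) : ℝ≥0∞ :=
  max (arrivalEpoch q a (departures q a v s + l)) s

/-- Both queues contain the jobs present at `s` and receive the same later arrivals, so only
departures survive in the difference. -/
theorem emulationError_eq (ha : IsCountingPath a) {s t : ℝ≥0} (hst : s ≤ t) :
    emulationError r q a v s t =
      ((emulatedDepartures r q a v s t : ℤ) + departures q a v s - departures q a v t).natAbs := by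
  have h1 := queueLength_add_departures q a v t
  have h2 := queueLength_add_departures q a v s
  have h3 := queueLength_add_departures (queueLength q a v s) (fun u => a (s + u) - a s)
    (fun _ => 1 / r) (t - s)
  have h4 := ha.mono hst
  rw [emulationError, msrEmulation, emulatedDepartures]
  simp only [add_tsub_cancel_of_le hst] at h3
  omega

theorem emulatedEpoch_eq (ha : IsCountingPath a) (s : ℝ≥0) (l : ℕ) :
    s + arrivalEpoch (queueLength q a v s) (fun u => a (s + u) - a s) l =
      emulatedEpoch q a v s l := by
  have h2 := queueLength_add_departures q a v s
  refine ENNReal.eq_of_forall_le_nnreal_iff fun t => ?_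
  rcases le_or_gt s t with hst | hst
  · obtain ⟨u, rfl⟩ := exists_add_of_le hst
    have h4 := ha.mono hst
    rw [emulatedEpoch, max_le_iff, ha.arrivalEpoch_le_iff, ENNReal.coe_add,
      ENNReal.add_le_add_iff_left (by simp), (ha.shift s).arrivalEpoch_le_iff]
    simp only [self_le_add_right, and_true]
    omega
  · have h5 : ¬ (s : ℝ≥0∞) ≤ t := by exact_mod_cast hst.not_ge
    exact ⟨fun h => absurd (le_self_add.trans h) h5,
      fun h => absurd ((le_max_right _ _).trans h) h5⟩

theorem lt_emulatedDepartures_iff (ha : IsCountingPath a) {s t : ℝ≥0} (hst : s ≤ t) {l : ℕ} :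
    l < emulatedDepartures r q a v s t ↔
      lindley (emulatedEpoch q a v s) (fun _ => ENNReal.ofReal (1 / r)) l ≤ t := by
  rw [emulatedDepartures, lt_departures_iff (ha.shift s), completionTime_eq_lindley,
    ENNReal.coe_sub, ENNReal.le_sub_iff_add_le_left (by simp) (by exact_mod_cast hst), lindley_add_const]
  simp only [emulatedEpoch_eq ha]

theorem le_lindley_emulatedEpoch {w : ℕ → ℝ≥0∞} (s : ℝ≥0) (l : ℕ) :
    (s : ℝ≥0∞) ≤ lindley (emulatedEpoch q a v s) w l :=
  (le_max_right _ _).trans (le_self_add.trans (le_lindley le_rfl))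

theorem lt_completionTime_departures_add (ha : IsCountingPath a) (s : ℝ≥0) (l : ℕ) :
    (s : ℝ≥0∞) < completionTime q a v (departures q a v s + l) := by
  rw [← not_le, ← lt_departures_iff ha]
  omega

theorem completionTime_lt_succ (hv : ∀ l, 0 < v l) {l : ℕ} (h : completionTime q a v l ≠ ∞) :
    completionTime q a v l < completionTime q a v (l + 1) := by
  simp only [completionTime_eq_lindley] at h ⊢
  exact lindley_lt_lindley_succ (by simpa using hv _) h

/-- Two counting processes with unit jumps cannot get `x` apart without being exactly `x` apart
at some earlier time. -/
theorem exists_count_eq_add {F G : ℕ → ℝ≥0∞} {f g : ℝ≥0 → ℕ} {s t : ℝ≥0} {x : ℕ} (hx : 1 ≤ x)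
    (hF : Monotone F) (hF' : ∀ l, F l ≠ ∞ → F l < F (l + 1)) (hFs : ∀ l, s ≤ F l)
    (hf : ∀ u, s ≤ u → ∀ l, l < f u ↔ F l ≤ u) (hg : ∀ u, s ≤ u → ∀ l, l < g u ↔ G l ≤ u)
    (hst : s ≤ t) (h : g t + x ≤ f t) :
    ∃ u, s ≤ u ∧ u ≤ t ∧ f u = g u + x := by
  classical
  have hgt : (t : ℝ≥0∞) < G (g t) := by
    rw [← not_le, ← hg t hst]; omega
  have hft : F (g t + x - 1) ≤ t := (hf t hst _).1 (by omega)
  -- `F (k + x - 1)` is the jump of `f` to `k + x`, and `G k` the jump of `g` to `k + 1`. The least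
  -- such `k` marks the first time that `f` leads by `x`: strictness of `F` prevents `f` from being
  -- larger there, and minimality prevents `g` from being smaller.
  have hex : ∃ k, F (k + x - 1) < G k := ⟨g t, hft.trans_lt hgt⟩
  set k := Nat.find hex with hk
  have hk1 : F (k + x - 1) < G k := Nat.find_spec hex
  have hkg : k ≤ g t := Nat.find_min' hex (hft.trans_lt hgt)
  have hkt : F (k + x - 1) ≤ t := (hF (by omega)).trans hft
  obtain ⟨u, hu⟩ := exists_coe_eq_of_ne_top (ne_top_of_le_ne_top ENNReal.coe_ne_top hkt)
  have hsu : s ≤ u := by have := hFs (k + x - 1); rw [← hu] at this; exact_mod_cast this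
  refine ⟨u, hsu, by rw [← hu] at hkt; exact_mod_cast hkt, ?_⟩
  have h1 : k + x - 1 < f u := (hf u hsu _).2 hu.ge
  have h2 : ¬ k + x < f u := by
    rw [hf u hsu, not_le, hu]
    have := hF' (k + x - 1) (by rw [← hu]; simp)
    rwa [show k + x - 1 + 1 = k + x by omega] at this
  have h3 : ¬ k < g u := by rw [hg u hsu, not_le, hu]; exact hk1
  have h4 : k ≤ g u := by
    rcases Nat.eq_zero_or_pos k with h0 | h0
    · omega
    · have h5 := Nat.find_min hex (m := k - 1) (by omega)
      rw [not_lt] at h5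
      have h6 : k - 1 < g u := (hg u hsu _).2 (h5.trans ((hF (by omega)).trans hu.ge))
      omega
  omega

theorem exists_emulationError_eq (ha : IsCountingPath a) (hr : 0 < r) (hv : ∀ l, 0 < v l) {x : ℕ}
    (hx : 1 ≤ x) {s t : ℝ≥0} (hst : s ≤ t) (h : x ≤ emulationError r q a v s t) :
    ∃ u, s ≤ u ∧ u ≤ t ∧ emulationError r q a v s u = x := by
  have hE : ∀ u, s ≤ u → ∀ l, l < emulatedDepartures r q a v s u ↔
      lindley (emulatedEpoch q a v s) (fun _ => ENNReal.ofReal (1 / r)) l ≤ u :=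
    fun u hu l => lt_emulatedDepartures_iff ha hu
  have hD : ∀ u, s ≤ u → ∀ l, l < departures q a v u - departures q a v s ↔
      completionTime q a v (departures q a v s + l) ≤ u := by
    intro u hu l
    rw [← lt_departures_iff ha]
    omega
  have hm := departures_mono (q := q) (v := v) ha hst
  rw [emulationError_eq ha hst] at h
  have key : ∃ u, s ≤ u ∧ u ≤ t ∧
      (emulatedDepartures r q a v s u = departures q a v u - departures q a v s + x ∨
       departures q a v u - departures q a v s = emulatedDepartures r q a v s u + x) := by
    rcases le_total (departures q a v t) (emulatedDepartures r q a v s t + departures q a v s)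
      with h1 | h1
    · obtain ⟨u, h2, h3, h4⟩ := exists_count_eq_add hx lindley_mono
        (fun l hl => lindley_lt_lindley_succ (by simpa using hr) hl)
        (le_lindley_emulatedEpoch s) hE hD hst (by omega)
      exact ⟨u, h2, h3, .inl h4⟩
    · obtain ⟨u, h2, h3, h4⟩ := exists_count_eq_add
        (F := fun l => completionTime q a v (departures q a v s + l))
        (f := fun u => departures q a v u - departures q a v s) hx (fun k l hkl => completionTime_mono (by omega))
        (fun l hl => completionTime_lt_succ hv hl)
        (fun l => (lt_completionTime_departures_add ha s l).le) hD hE hst (by omega)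
      exact ⟨u, h2, h3, .inr h4⟩
  obtain ⟨u, h2, h3, h4⟩ := key
  have hm' := departures_mono (q := q) (v := v) ha h2
  exact ⟨u, h2, h3, by rw [emulationError_eq ha h2]; omega⟩

/-- Departure counts are locally constant to the right. This makes the infimum in `messageTime`
attained, and later reduces message events to countably many times. -/
theorem emulationError_eventually_eq (ha : IsCountingPath a) {s t : ℝ≥0} (hst : s ≤ t) :
    ∃ u > t, ∀ w, t ≤ w → w < u →
      emulationError r q a v s w = emulationError r q a v s t := by
  obtain ⟨u, hu, h⟩ := departures_eventually_eq (q := q) (v := v) ha t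
  obtain ⟨u', hu', h'⟩ := departures_eventually_eq (q := queueLength q a v s) (v := fun _ => 1 / r)
    (ha.shift s) (t - s)
  refine ⟨min u (s + u'), lt_min hu ((tsub_lt_iff_left hst).1 hu'), fun w h1 h2 => ?_⟩
  have hsw := hst.trans h1
  rw [emulationError_eq ha hst, emulationError_eq ha hsw, h w h1 (h2.trans_le (min_le_left _ _)),
    emulatedDepartures, emulatedDepartures, h' (w - s) (by gcongr)
      ((tsub_lt_iff_left hsw).2 (h2.trans_le (min_le_right _ _)))]

end Emulation

/-! ### Messaging times -/

section Message

variable {q : ℕ} {a : ℝ≥0 → ℕ} {v : ℕ → ℝ} {r : ℝ} {x : ℕ}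

theorem messageTime_le_succ (m : ℕ) :
    messageTime x r q a v m ≤ messageTime x r q a v (m + 1) :=
  le_iInf₂ fun _ h => h.1

theorem messageTime_succ_le {s : ℝ≥0} {m : ℕ} (hs : messageTime x r q a v m = s) {t : ℝ≥0}
    (hst : s ≤ t) (h : emulationError r q a v s t = x) : messageTime x r q a v (m + 1) ≤ t :=
  iInf₂_le t ⟨by rw [hs]; exact_mod_cast hst, by rw [hs]; exact h⟩

theorem emulationError_messageTime (ha : IsCountingPath a) {m : ℕ} {s t : ℝ≥0}
    (hs : messageTime x r q a v m = s) (ht : messageTime x r q a v (m + 1) = t) :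
    s ≤ t ∧ emulationError r q a v s t = x := by
  have hst : s ≤ t := by
    have := messageTime_le_succ (x := x) (r := r) (q := q) (a := a) (v := v) m
    rw [hs, ht] at this
    exact_mod_cast this
  refine ⟨hst, ?_⟩
  obtain ⟨u, hu, h⟩ := emulationError_eventually_eq (r := r) (q := q) (v := v) ha hst
  have hlt : messageTime x r q a v (m + 1) < u := by rw [ht]; exact_mod_cast hu
  rw [messageTime] at hlt
  simp only [iInf_lt_iff] at hlt
  obtain ⟨w, ⟨h1, h2⟩, h3⟩ := hlt
  rw [hs] at h1 h2
  have htw : (t : ℝ≥0∞) ≤ w := ht ▸ messageTime_succ_le hs (by exact_mod_cast h1) h2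
  rw [← h w (by exact_mod_cast htw) (by exact_mod_cast h3)]
  exact h2

/-- Between consecutive messages the error goes from `0` to `x ≥ 1`, so some departure occurs:
either from the server, or from the emulation, which takes at least `1 / r`. Either way `D(t) + r t`
grows by at least one, which excludes infinitely many messages in finite time. -/
theorem natCast_le_departures_add (ha : IsCountingPath a) (hr : 0 < r) (hx : 1 ≤ x) (m : ℕ) :
    ∀ t : ℝ≥0, messageTime x r q a v m = t → (m : ℝ) ≤ departures q a v t + r * t := by
  induction m with
  | zero => intro t _; simp only [CharP.cast_eq_zero]; positivity
  | succ m ih =>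
    intro t ht
    have hne : messageTime x r q a v m ≠ ∞ :=
      ne_top_of_le_ne_top (by simp [ht]) (messageTime_le_succ m)
    obtain ⟨s, hs⟩ := exists_coe_eq_of_ne_top hne
    obtain ⟨hst, herr⟩ := emulationError_messageTime ha hs.symm ht
    have him := ih s hs.symm
    have hm := departures_mono (q := q) (v := v) ha hst
    rw [emulationError_eq ha hst] at herr
    have hst' : (s : ℝ) ≤ t := by exact_mod_cast hst
    rcases Nat.lt_or_ge (departures q a v s) (departures q a v t) with h1 | h1
    · have : (departures q a v s : ℝ) + 1 ≤ departures q a v t := by exact_mod_cast h1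
      push_cast
      nlinarith
    · have h0 : 0 < emulatedDepartures r q a v s t := by omega
      rw [lt_emulatedDepartures_iff ha hst] at h0
      have h2 : (s : ℝ≥0∞) + ENNReal.ofReal (1 / r) ≤ t :=
        (add_le_add_left (le_max_right _ _) _).trans h0
      have h3 : (s : ℝ) + 1 / r ≤ t := by
        have := ENNReal.toReal_mono (by simp) h2
        rwa [ENNReal.toReal_add (by simp) (by simp), ENNReal.toReal_ofReal (by positivity)] at this
      have h4 : r * (s + 1 / r) = r * s + 1 := by field_simp
      have h5 := mul_le_mul_of_nonneg_left h3 hr.le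
      have : (departures q a v s : ℝ) ≤ departures q a v t := by exact_mod_cast hm
      push_cast
      linarith

theorem bddAbove_messageTime_le (ha : IsCountingPath a) (hr : 0 < r) (hx : 1 ≤ x) (t : ℝ≥0) :
    BddAbove {m : ℕ | messageTime x r q a v m ≤ t} := by
  obtain ⟨M, hM⟩ := exists_nat_ge ((departures q a v t : ℝ) + r * t)
  refine ⟨M, fun m hm => ?_⟩
  obtain ⟨s, hs⟩ := exists_coe_eq_of_ne_top (ne_top_of_le_ne_top (by simp) hm.out)
  have hst : s ≤ t := by have := hm.out; rw [← hs] at this; exact_mod_cast this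
  have h1 := natCast_le_departures_add (q := q) (v := v) ha hr hx m s hs.symm
  have h2 : (departures q a v s : ℝ) ≤ departures q a v t := by
    exact_mod_cast departures_mono ha hst
  have h3 : (s : ℝ) ≤ t := by exact_mod_cast hst
  have : (m : ℝ) ≤ M := by nlinarith
  exact_mod_cast this

theorem approxError_lt (ha : IsCountingPath a) (hr : 0 < r) (hv : ∀ l, 0 < v l) (hx : 1 ≤ x)
    (t : ℝ≥0) : approxError x r q a v t < x := by
  have hb := bddAbove_messageTime_le (q := q) (v := v) ha hr hx t
  have hmem : messageTime x r q a v (messageCount x r q a v t) ≤ t :=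
    Nat.sSup_mem (s := {m : ℕ | messageTime x r q a v m ≤ t}) ⟨0, by simp [messageTime]⟩ hb
  obtain ⟨s, hs⟩ := exists_coe_eq_of_ne_top (ne_top_of_le_ne_top (by simp) hmem)
  by_contra! h
  rw [approxError, approxQueue, ← hs, ENNReal.toNNReal_coe] at h
  have hst : s ≤ t := by rw [← hs] at hmem; exact_mod_cast hmem
  obtain ⟨u, hsu, hut, hu⟩ := exists_emulationError_eq ha hr hv hx hst h
  have h1 : messageTime x r q a v (messageCount x r q a v t + 1) ≤ t :=
    (messageTime_succ_le hs.symm hsu hu).trans (by exact_mod_cast hut)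
  have h2 : messageCount x r q a v t + 1 ≤ messageCount x r q a v t := le_csSup hb h1
  omega

end Message

/-! ### The stopped walk

For residual requirements `W l`, the walk increases by one at each completion and decreases at
rate `r` while the server works. It is stopped when its absolute value reaches `lam`. -/

/-- The value of the walk after a job of requirement `W`, from the value `y`. A job without
requirement does not count. -/
def walkStep (lam r y W : ℝ) : ℝ :=
  if lam ≤ |y| ∨ W ≤ 0 then y else if r * W ≤ y + lam then y + 1 - r * W else -lam

/-- The work performed on a job of requirement `W` before the walk, currently at `y`, stops. -/
def walkWork (lam r y W : ℝ) : ℝ :=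
  if lam ≤ |y| then 0 else min W ((y + lam) / r)

/-- The stopped walk, observed at the completions. -/
def stoppedWalk (lam r : ℝ) (W : ℕ → ℝ) : ℕ → ℝ
  | 0 => 0
  | l + 1 => walkStep lam r (stoppedWalk lam r W l) (W l)

section Walk

variable {lam r : ℝ} {W : ℕ → ℝ}

theorem stoppedWalk_eq_of_le {l n : ℕ} (hln : l ≤ n) (h : lam ≤ |stoppedWalk lam r W l|) :
    stoppedWalk lam r W n = stoppedWalk lam r W l := by
  induction n, hln using Nat.le_induction with
  | base => rfl
  | succ n _ ih => rw [stoppedWalk, ih, walkStep, if_pos (.inl h)]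

theorem walkWork_le {y w : ℝ} (hw : 0 ≤ w) : walkWork lam r y w ≤ w := by
  unfold walkWork
  split_ifs
  exacts [hw, min_le_left _ _]

theorem walkWork_nonneg (hr : 0 < r) {y w : ℝ} (hw : 0 ≤ w) : 0 ≤ walkWork lam r y w := by
  unfold walkWork
  split_ifs with h
  · exact le_rfl
  · have := (abs_lt.1 (not_le.1 h)).1
    exact le_min hw (div_nonneg (by linarith) hr.le)

theorem stoppedWalk_sub {j n : ℕ} (hjn : j ≤ n) (hW : ∀ l, j ≤ l → l < n → 0 < W l)
    (h : ∀ l ≤ n, |stoppedWalk lam r W l| < lam) :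
    stoppedWalk lam r W n - stoppedWalk lam r W j =
      (n : ℝ) - j - r * ∑ k ∈ Finset.Ico j n, W k := by
  induction n, hjn using Nat.le_induction with
  | base => simp
  | succ n hjn ih =>
    have ih := ih (fun l h1 h2 => hW l h1 (by omega)) (fun l hl => h l (by omega))
    have h1 := h (n + 1) le_rfl
    have h2 := h n (by omega)
    have h3 := hW n hjn (by omega)
    rw [Finset.sum_Ico_succ_top hjn]
    rw [stoppedWalk, walkStep, if_neg (by push Not; exact ⟨h2, h3⟩)] at h1 ⊢
    split_ifs at h1 ⊢
    · push_cast
      linarith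
    · rw [abs_neg] at h1
      exact absurd (le_abs_self lam) h1.not_ge

end Walk

/-! ### Residual requirements and the pathwise comparison with the stopped walk -/

section Residual

variable {q : ℕ} {a : ℝ≥0 → ℕ} {v : ℕ → ℝ} {r : ℝ} {x : ℕ}

theorem sum_Icc_ofReal {W : ℕ → ℝ} (hW : ∀ l, 0 ≤ W l) (d j m : ℕ) :
    ∑ k ∈ Finset.Icc j m, ENNReal.ofReal (W (d + k)) =
      ENNReal.ofReal (∑ k ∈ Finset.Ico (d + j) (d + (m + 1)), W k) := by
  rw [← ENNReal.ofReal_sum_of_nonneg (fun _ _ => hW _), ← Finset.Ico_add_one_right_eq_Icc,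
    Finset.sum_Ico_add, add_comm j, add_comm (m + 1)]

theorem sum_Icc_ofReal_const {c : ℝ} (hc : 0 ≤ c) {j m : ℕ} (h : j ≤ m) :
    ∑ _k ∈ Finset.Icc j m, ENNReal.ofReal c = ENNReal.ofReal (((m : ℝ) + 1 - j) * c) := by
  rw [← ENNReal.ofReal_sum_of_nonneg (fun _ _ => hc), Finset.sum_const, Nat.card_Icc,
    nsmul_eq_mul, Nat.cast_sub (by omega)]
  push_cast
  rfl

/-- `W` is the sequence of residual requirements after time `s`: zero for the jobs completed by
then, the remaining requirement for the job in service, the requirement for the others. -/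
structure IsResidual (q : ℕ) (a : ℝ≥0 → ℕ) (v : ℕ → ℝ) (s : ℝ≥0) (W : ℕ → ℝ) : Prop where
  nonneg : ∀ l, 0 ≤ W l
  eq_zero : ∀ l < departures q a v s, W l = 0
  completion : ∀ l, departures q a v s ≤ l → serviceStart q a v l ≠ ∞ →
    completionTime q a v l = max (serviceStart q a v l) s + ENNReal.ofReal (W l)

variable {s t : ℝ≥0} {W : ℕ → ℝ}

theorem IsResidual.pos (hW : IsResidual q a v s W) (ha : IsCountingPath a) (hv : ∀ l, 0 < v l)
    {l : ℕ} (hl : departures q a v s ≤ l) (hB : serviceStart q a v l ≠ ∞) : 0 < W l := by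
  have h1 := hW.completion l hl hB
  have h2 : max (serviceStart q a v l) s < completionTime q a v l := by
    refine max_lt ?_ ?_
    · rw [completionTime_eq_serviceStart_add]
      exact ENNReal.lt_add_right hB (by simpa using hv l)
    · obtain ⟨k, rfl⟩ := Nat.exists_eq_add_of_le hl
      exact lt_completionTime_departures_add ha s k
  by_contra! h
  rw [ENNReal.ofReal_of_nonpos h, add_zero] at h1
  exact h2.ne' h1

/-- After `s` the server is itself a FIFO queue restarted at `s`, with the epochs of the emulation
and the residual requirements. Both systems can then be compared epoch by epoch. -/
theorem IsResidual.completionTime_eq (hW : IsResidual q a v s W) (ha : IsCountingPath a) (k : ℕ)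
    (hk : serviceStart q a v (departures q a v s + k) ≠ ∞) :
    completionTime q a v (departures q a v s + k) =
      lindley (emulatedEpoch q a v s)
        (fun k => ENNReal.ofReal (W (departures q a v s + k))) k := by
  induction k with
  | zero =>
    have h1 : prevCompletion q a v (departures q a v s) ≤ s := (le_departures_iff ha).1 le_rfl
    rw [hW.completion _ (by omega) hk, lindley, emulatedEpoch, add_zero, serviceStart, max_assoc,
      max_eq_right h1]
  | succ k ih =>
    have h1 : serviceStart q a v (departures q a v s + (k + 1)) =
      max (arrivalEpoch q a (departures q a v s + (k + 1)))
        (completionTime q a v (departures q a v s + k)) := rfl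
    have h2 : completionTime q a v (departures q a v s + k) ≠ ∞ :=
      ne_top_of_le_ne_top hk (h1 ▸ le_max_right _ _)
    have h3 := ih (ne_top_of_le_ne_top h2 (by
      rw [completionTime_eq_serviceStart_add]; exact le_self_add))
    rw [hW.completion _ (by omega) hk, lindley, ← h3, h1, emulatedEpoch, max_assoc, max_assoc,
      max_comm (s : ℝ≥0∞)]

/-- The index is `D(t) + 1` because the walk may hit `-lam` in the middle of the service in progress
at time `t`; `walkWork` then counts only the part of that service performed before the hit, which is
over by `t`. -/
theorem IsResidual.stoppedWalk_bounds (hW : IsResidual q a v s W) (ha : IsCountingPath a)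
    (hr : 0 < r) (hv : ∀ l, 0 < v l) (hx : 3 ≤ x) (hst : s ≤ t)
    (herr : emulationError r q a v s t = x) {lam : ℝ} (hlam : lam = x / 2 - 1) :
    lam ≤ |stoppedWalk lam r W (departures q a v t + 1)| ∧
      (s : ℝ) + (∑ k ∈ Finset.Ico (departures q a v s) (departures q a v t), W k +
        walkWork lam r (stoppedWalk lam r W (departures q a v t)) (W (departures q a v t))) ≤ t := by
  set d := departures q a v s with hd
  set e := departures q a v t with he
  set y := stoppedWalk lam r W with hy
  have hde : d ≤ e := departures_mono ha hst
  have hr' : 0 ≤ 1 / r := by positivity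
  have hst' : (s : ℝ) ≤ t := by exact_mod_cast hst
  have hstart : ∀ l < e, serviceStart q a v l ≠ ∞ ∧ completionTime q a v l ≤ t := by
    intro l hl
    have h1 := (lt_departures_iff ha).1 hl
    refine ⟨ne_top_of_le_ne_top (b := (t : ℝ≥0∞)) ENNReal.coe_ne_top ?_, h1⟩
    exact le_trans (by rw [completionTime_eq_serviceStart_add]; exact le_self_add) h1
  have hpos : ∀ l, d ≤ l → l < e → 0 < W l := fun l h1 h2 => hW.pos ha hv h1 (hstart l h2).1
  have hsum : (s : ℝ) + ∑ k ∈ Finset.Ico d e, W k ≤ t := by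
    rcases hde.eq_or_lt with h | h
    · simpa [h] using hst'
    · obtain ⟨n, hn⟩ : ∃ n, e = d + (n + 1) := ⟨e - d - 1, by omega⟩
      obtain ⟨h1, h2⟩ := hstart (d + n) (by omega)
      rw [hW.completionTime_eq ha n h1] at h2
      have h3 := (le_lindley (Nat.zero_le n)).trans h2
      rw [sum_Icc_ofReal hW.nonneg, add_zero, ← hd, ← hn] at h3
      have h4 := ENNReal.toReal_mono ENNReal.coe_ne_top
        ((add_le_add_left (le_max_right _ _) _).trans h3)
      rwa [ENNReal.toReal_add (by simp) (by simp),
        ENNReal.toReal_ofReal (Finset.sum_nonneg fun _ _ => hW.nonneg _)] at h4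
  -- If the level was reached at a completion, the walk is frozen and no further work counts.
  -- Otherwise all increments up to `e` are the unstopped ones.
  by_cases hreach : ∃ l ≤ e, lam ≤ |y l|
  · obtain ⟨l, hl, hyl⟩ := hreach
    refine ⟨by rw [hy, stoppedWalk_eq_of_le (show l ≤ e + 1 by omega) hyl]; exact hyl, ?_⟩
    rw [walkWork, if_pos (by rw [hy, stoppedWalk_eq_of_le hl hyl]; exact hyl), add_zero]
    exact hsum
  push Not at hreach
  have hx3 : (3 : ℝ) ≤ x := by exact_mod_cast hx
  have hdiff : ∀ j, d ≤ j → j ≤ e → y e - y j = (e : ℝ) - j - r * ∑ k ∈ Finset.Ico j e, W k :=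
    fun j h1 h2 => stoppedWalk_sub h2 (fun l h3 h4 => hpos l (h1.trans h3) h4) hreach
  rw [emulationError_eq ha hst] at herr
  set N := emulatedDepartures r q a v s t with hN
  rcases le_total e (N + d) with hcase | hcase
  · -- the emulation is ahead of the server
    obtain ⟨n, hn⟩ := Nat.exists_eq_add_of_le hde
    have hNn : N = n + x := by omega
    have h1 := (lt_emulatedDepartures_iff (r := r) (q := q) (v := v) ha hst
      (l := n + x - 1)).1 (by omega)
    -- The emulation has finished job `n + x - 1`, so every term of its maximum is at most `t`; the
    -- choice of `j` is left to the server.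
    have hjt : ∀ j ≤ n, emulatedEpoch q a v s j +
        ENNReal.ofReal (((n : ℝ) + x - j) * (1 / r)) ≤ t := by
      intro j hj
      have := (le_lindley (show j ≤ n + x - 1 by omega)).trans h1
      rw [sum_Icc_ofReal_const hr' (by omega), Nat.cast_sub (by omega)] at this
      push_cast at this
      rwa [sub_add_cancel] at this
    have hB : serviceStart q a v e ≤ t := by
      refine max_le ?_ ((le_departures_iff ha).1 le_rfl)
      have := le_self_add.trans (hjt n le_rfl)
      rw [hn]
      exact (le_max_left _ _).trans this
    have hBtop := ne_top_of_le_ne_top ENNReal.coe_ne_top hB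
    obtain ⟨b, hb⟩ := exists_coe_eq_of_ne_top
      (ne_top_of_le_ne_top ENNReal.coe_ne_top (max_le hB (show (s : ℝ≥0∞) ≤ t by exact_mod_cast hst)))
    have hCe := hW.completion e hde hBtop
    have hCl : completionTime q a v e = _ := hn ▸ hW.completionTime_eq ha n (hn ▸ hBtop)
    have htC : (t : ℝ≥0∞) < completionTime q a v e := by
      rw [← not_le, ← lt_departures_iff ha]; omega
    have hnnI : ∀ j k, 0 ≤ ∑ i ∈ Finset.Ico j k, W i := fun j k =>
      Finset.sum_nonneg fun _ _ => hW.nonneg _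
    rw [← hb] at hCe
    -- Here `j` opens the busy period of the server that contains job `e`; the service of `e`
    -- begins, or resumes after `s`, at time `b`.
    obtain ⟨j, hj, hXj⟩ := exists_lindley_eq (emulatedEpoch q a v s)
      (fun k => ENNReal.ofReal (W (departures q a v s + k))) n
    have hX0 := le_lindley (e := emulatedEpoch q a v s)
      (w := fun k => ENNReal.ofReal (W (departures q a v s + k))) (Nat.zero_le n)
    rw [← hCl, hCe, sum_Icc_ofReal hW.nonneg, ← hd] at hX0 hXj
    rw [show d + (n + 1) = e + 1 by omega, Finset.sum_Ico_succ_top (by omega)] at hX0 hXj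
    obtain ⟨ε, hε⟩ := exists_coe_eq_of_ne_top
      (ne_top_of_le_ne_top ENNReal.coe_ne_top (le_self_add.trans (hjt j hj)))
    have h2 := hjt j hj
    rw [← hε] at h2 hXj
    have h2 := ENNReal.toReal_mono ENNReal.coe_ne_top h2
    have hjn : (j : ℝ) ≤ n := by exact_mod_cast hj
    rw [ENNReal.toReal_add (by simp) (by simp), ENNReal.toReal_ofReal (by
      apply mul_nonneg _ hr'; linarith)] at h2
    have h3 := congrArg ENNReal.toReal hXj
    rw [ENNReal.toReal_add (by simp) (by simp), ENNReal.toReal_add (by simp) (by simp),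
      ENNReal.toReal_ofReal (hW.nonneg _),
      ENNReal.toReal_ofReal (add_nonneg (hnnI _ _) (hW.nonneg _))] at h3
    have h4 := ENNReal.toReal_mono (by simp) ((add_le_add_left (le_max_right _ _) _).trans hX0)
    rw [ENNReal.toReal_add (by simp) (by simp), ENNReal.toReal_add (by simp) (by simp),
      ENNReal.toReal_ofReal (hW.nonneg _),
      ENNReal.toReal_ofReal (add_nonneg (hnnI _ _) (hW.nonneg _)), add_zero] at h4
    rw [hCe] at htC
    have h5 := ENNReal.toReal_strict_mono (by simp) htC
    rw [ENNReal.toReal_add (by simp) (by simp), ENNReal.toReal_ofReal (hW.nonneg _)] at h5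
    simp only [ENNReal.coe_toReal] at h2 h3 h4 h5
    have h6 := hdiff (d + j) (by omega) (by omega)
    have h7 : r * (ε + ((n : ℝ) + x - j) * (1 / r)) = r * ε + (n + x - j) := by field_simp
    have h8 := mul_le_mul_of_nonneg_left h2 hr.le
    have h9 : (e : ℝ) = d + n := by exact_mod_cast hn
    have hyj := (abs_lt.1 (hreach (d + j) (by omega))).2
    push_cast at h6
    -- The two time bounds give `r (t - b) ≥ y e - y (d + j) + x`, and `y (d + j) < lam` with `x = 2
    -- lam + 2` concludes: the service in progress has already driven the walk down to `-lam`.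
    have h10 : y e + lam ≤ r * (t - b) := by
      have : (b : ℝ) = ε + ∑ k ∈ Finset.Ico (d + j) e, W k := by linarith
      rw [this]
      nlinarith
    have h11 : (y e + lam) / r ≤ t - b := by
      rw [div_le_iff₀ hr]; linarith
    have h12 : y e + lam < r * W e := h10.trans_lt (by gcongr; linarith)
    have h13 := hreach e le_rfl
    constructor
    · rw [hy, stoppedWalk, walkStep, if_neg, if_neg h12.not_ge, abs_neg]
      · exact le_abs_self _
      · push Not
        exact ⟨h13, hW.pos ha hv hde hBtop⟩
    · rw [walkWork, if_neg h13.not_ge]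
      have := min_le_right (W e) ((y e + lam) / r)
      linarith
  · -- the server is ahead of the emulation
    exfalso
    have he' : e = d + (N + x) := by omega
    have h1 : ¬ N < emulatedDepartures r q a v s t := by omega
    rw [lt_emulatedDepartures_iff ha hst, not_le] at h1
    -- Now `j` attains the maximum for the unfinished job `N` of the emulation. The server has
    -- completed jobs `j` to `N + x - 1` by `t`, so `y` rose by more than `x - 1 = 2 lam + 1`
    -- between indices `d + j` and `e`, which is impossible inside `(-lam, lam)`.
    obtain ⟨j, hj, hXj⟩ := exists_lindley_eq (emulatedEpoch q a v s)
      (fun _ => ENNReal.ofReal (1 / r)) N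
    rw [sum_Icc_ofReal_const hr' hj] at hXj
    obtain ⟨h2, h3⟩ := hstart (d + (N + x - 1)) (by omega)
    rw [hW.completionTime_eq ha _ h2] at h3
    have h4 := (le_lindley (show j ≤ N + x - 1 by omega)).trans h3
    rw [sum_Icc_ofReal hW.nonneg, ← hd, show d + (N + x - 1 + 1) = e by omega] at h4
    have h5 := lt_of_add_lt_add_left (hXj ▸ h4.trans_lt h1)
    have hjn : (j : ℝ) ≤ N := by exact_mod_cast hj
    have h6 := (ENNReal.ofReal_lt_ofReal_iff_of_nonneg (Finset.sum_nonneg fun _ _ => hW.nonneg _)).1 h5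
    have h7 := hdiff (d + j) (by omega) (by omega)
    have h8 := mul_lt_mul_of_pos_left h6 hr
    have h9 : r * (((N : ℝ) + 1 - j) * (1 / r)) = N + 1 - j := by field_simp
    have h10 : (e : ℝ) = d + (N + x) := by exact_mod_cast he'
    have h11 := (abs_lt.1 (hreach (d + j) (by omega))).1
    have h12 := (abs_lt.1 (hreach e le_rfl)).2
    push_cast at h7
    linarith

/-- Work takes real time, since the server has unit speed. Jobs completed before `s` have residual
zero, and jobs after `D(t)` find the walk already frozen. -/
theorem IsResidual.sum_walkWork_le (hW : IsResidual q a v s W) (ha : IsCountingPath a)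
    (hr : 0 < r) (hv : ∀ l, 0 < v l) (hx : 3 ≤ x) (hst : s ≤ t)
    (herr : emulationError r q a v s t = x) {lam : ℝ} (hlam : lam = x / 2 - 1) (n : ℕ) :
    ∑ l ∈ Finset.range n, ENNReal.ofReal (walkWork lam r (stoppedWalk lam r W l) (W l)) ≤
      t - s := by
  obtain ⟨h1, h2⟩ := hW.stoppedWalk_bounds ha hr hv hx hst herr hlam
  set d := departures q a v s with hd
  set e := departures q a v t with he
  have hde : d ≤ e := departures_mono ha hst
  have h3 : ∀ l, e + 1 ≤ l → walkWork lam r (stoppedWalk lam r W l) (W l) = 0 := fun l hl => by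
    rw [walkWork, if_pos (by rw [stoppedWalk_eq_of_le hl h1]; exact h1)]
  have h4 : ∑ l ∈ Finset.range e, W l = ∑ k ∈ Finset.Ico d e, W k := by
    rw [← Finset.sum_range_add_sum_Ico _ hde, Finset.sum_eq_zero, zero_add]
    exact fun l hl => hW.eq_zero l (Finset.mem_range.1 hl)
  calc ∑ l ∈ Finset.range n, ENNReal.ofReal (walkWork lam r (stoppedWalk lam r W l) (W l))
      ≤ ∑ l ∈ Finset.range (e + 1),
          ENNReal.ofReal (walkWork lam r (stoppedWalk lam r W l) (W l)) := by
        refine Finset.sum_le_sum_of_ne_zero fun l _ hl => ?_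
        by_contra hle
        exact hl (by rw [h3 l (by simpa using hle), ENNReal.ofReal_zero])
    _ ≤ ENNReal.ofReal (∑ l ∈ Finset.range e, W l) +
          ENNReal.ofReal (walkWork lam r (stoppedWalk lam r W e) (W e)) := by
        rw [Finset.sum_range_succ, ENNReal.ofReal_sum_of_nonneg (fun _ _ => hW.nonneg _)]
        gcongr with l hl
        exact walkWork_le (hW.nonneg l)
    _ ≤ t - s := by
        rw [h4]
        refine ENNReal.le_sub_of_add_le_left (by simp) ?_
        rw [← ENNReal.ofReal_add (Finset.sum_nonneg fun _ _ => hW.nonneg _)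
          (walkWork_nonneg hr (hW.nonneg _)), ← ENNReal.ofReal_coe_nnreal (p := s),
          ← ENNReal.ofReal_coe_nnreal (p := t), ← ENNReal.ofReal_add (by positivity) (add_nonneg
            (Finset.sum_nonneg fun _ _ => hW.nonneg _) (walkWork_nonneg hr (hW.nonneg _)))]
        exact ENNReal.ofReal_le_ofReal h2

end Residual

/-! ### Second moments of the stopped walk -/

theorem measurable_walkStep (lam r : ℝ) :
    Measurable fun p : ℝ × ℝ => walkStep lam r p.1 p.2 := by
  unfold walkStep
  refine Measurable.ite ?_ (by fun_prop) (Measurable.ite ?_ (by fun_prop) (by fun_prop))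
  · exact (measurableSet_le (f := fun _ : ℝ × ℝ => lam) (g := fun p => |p.1|)
      (by fun_prop) (by fun_prop)).union
      (measurableSet_le (f := fun p : ℝ × ℝ => p.2) (by fun_prop) measurable_const)
  · exact measurableSet_le (by fun_prop) (by fun_prop)

theorem measurable_walkWork (lam r : ℝ) :
    Measurable fun p : ℝ × ℝ => walkWork lam r p.1 p.2 := by
  unfold walkWork
  exact Measurable.ite (measurableSet_le (by fun_prop) (by fun_prop)) (by fun_prop) (by fun_prop)

theorem measureReal_expMeasure_Iic {r a : ℝ} (hr : 0 < r) (ha : 0 ≤ a) :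
    (expMeasure r).real (Iic a) = 1 - Real.exp (-(r * a)) := by
  have := isProbabilityMeasure_expMeasure hr
  rw [← cdf_eq_real, cdf_expMeasure_eq hr, if_pos ha]

theorem setIntegral_expMeasure_Ioc {r a b : ℝ} (hr : 0 < r) (ha : 0 ≤ a) (hab : a ≤ b)
    {F f : ℝ → ℝ} (hf : Continuous f)
    (hF : ∀ v, HasDerivAt F (r * Real.exp (-(r * v)) * f v) v) :
    ∫ v in Ioc a b, f v ∂(expMeasure r) = F b - F a := by
  have hm : Measurable (gammaPDF 1 r) :=
    ENNReal.measurable_ofReal.comp (measurable_gammaPDFReal 1 r)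
  rw [expMeasure, gammaMeasure, setIntegral_withDensity_eq_setIntegral_toReal_smul
    hm
    (by simp [gammaPDF]) _ measurableSet_Ioc]
  rw [← intervalIntegral.integral_eq_sub_of_hasDerivAt (fun v _ => hF v)
    (Continuous.intervalIntegrable (by fun_prop) _ _), intervalIntegral.integral_of_le hab]
  refine setIntegral_congr_fun measurableSet_Ioc fun v hv => ?_
  have hv : 0 ≤ v := ha.trans hv.1.le
  have h1 : gammaPDF 1 r v = exponentialPDF r v := rfl
  simp only [h1, exponentialPDF_of_nonneg hv, smul_eq_mul]
  rw [ENNReal.toReal_ofReal (by positivity)]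

theorem abs_walkStep_le {lam r y w : ℝ} (hlam : 0 < lam) (hr : 0 < r) :
    |walkStep lam r y w| ≤ |y| + 1 + lam := by
  have h1 := le_abs_self y
  have h2 := neg_abs_le y
  unfold walkStep
  split_ifs with h3 h4
  · linarith
  · push Not at h3
    have := mul_pos hr h3.2
    rw [abs_le]
    constructor <;> linarith
  · rw [abs_neg, abs_of_pos hlam]
    linarith [abs_nonneg y]

/-- One-step martingale identity for `y ^ 2 - r * work`, where `a` is the service already received.
On `v ≤ a` the job was completed earlier and nothing moves; on `v > a` the excess `v - a` is again
exponential by lack of memory. -/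
theorem integral_walkStep_sq {lam r y a : ℝ} (hlam : 0 < lam) (hr : 0 < r) (ha : 0 ≤ a)
    (hy : |y| < lam) :
    ∫ v, (walkStep lam r y (max (v - a) 0) ^ 2 - r * walkWork lam r y (max (v - a) 0))
      ∂(expMeasure r) = y ^ 2 := by
  have hp := isProbabilityMeasure_expMeasure hr
  obtain ⟨hy1, hy2⟩ := abs_lt.1 hy
  set c := (y + lam) / r with hc
  have hrc : r * c = y + lam := by rw [hc]; field_simp
  have hc0 : 0 < c := div_pos (by linarith) hr
  set g : ℝ → ℝ := fun v =>
    walkStep lam r y (max (v - a) 0) ^ 2 - r * walkWork lam r y (max (v - a) 0) with hg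
  have hgm : Measurable g := by
    have h1 := (measurable_walkStep lam r).comp
      (show Measurable fun v : ℝ => (y, max (v - a) 0) by fun_prop)
    have h2 := (measurable_walkWork lam r).comp
      (show Measurable fun v : ℝ => (y, max (v - a) 0) by fun_prop)
    exact (h1.pow_const 2).sub (h2.const_mul r)
  have hgi : Integrable g (expMeasure r) := by
    refine Integrable.of_bound hgm.aestronglyMeasurable
      ((|y| + 1 + lam) ^ 2 + r * c) (Filter.Eventually.of_forall fun v => ?_)
    have h1 := abs_walkStep_le (y := y) (w := max (v - a) 0) hlam hr
    have h2 : walkWork lam r y (max (v - a) 0) ≤ c := by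
      rw [walkWork, if_neg hy.not_ge]; exact min_le_right _ _
    have h3 := walkWork_nonneg (lam := lam) hr (y := y) (le_max_right (v - a) 0)
    have h4 := sq_le_sq' (by linarith [abs_le.1 h1]) ((le_abs_self _).trans h1)
    have h5 := mul_le_mul_of_nonneg_left h2 hr.le
    have h6 := mul_nonneg hr.le h3
    rw [Real.norm_eq_abs, abs_le]
    constructor <;> nlinarith [sq_nonneg (walkStep lam r y (max (v - a) 0)),
      sq_nonneg (|y| + 1 + lam)]
  have hg1 : EqOn g (fun _ => y ^ 2) (Iic a) := fun v hv => by
    have h : max (v - a) 0 = 0 := max_eq_right (by simpa using hv)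
    simp only [hg, h, walkStep, walkWork, le_refl, or_true, if_true, if_neg hy.not_ge]
    rw [min_eq_left hc0.le]; ring
  have hg2 : EqOn g (fun v => (y + 1 - r * (v - a)) ^ 2 - r * (v - a)) (Ioc a (a + c)) :=
    fun v hv => by
      have h : max (v - a) 0 = v - a := max_eq_left (by linarith [hv.1])
      have h1 : v - a ≤ c := by linarith [hv.2]
      have h2 : r * (v - a) ≤ y + lam := hrc ▸ mul_le_mul_of_nonneg_left h1 hr.le
      simp only [hg, h, walkStep, walkWork, if_neg hy.not_ge]
      rw [min_eq_left h1, if_neg (by push Not; exact ⟨hy, by linarith [hv.1]⟩), if_pos h2]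
  have hg3 : EqOn g (fun _ => lam ^ 2 - r * c) (Ioi (a + c)) := fun v hv => by
    have hv : a + c < v := hv
    have h : max (v - a) 0 = v - a := max_eq_left (by linarith)
    have h1 : c < v - a := by linarith
    have h2 : y + lam < r * (v - a) := hrc ▸ mul_lt_mul_of_pos_left h1 hr
    simp only [hg, h, walkStep, walkWork, if_neg hy.not_ge]
    rw [min_eq_right h1.le, if_neg (by push Not; exact ⟨hy, by linarith⟩), if_neg h2.not_ge]
    ring
  have hI1 : ∫ v in Iic a, g v ∂(expMeasure r) = (1 - Real.exp (-(r * a))) * y ^ 2 := by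
    rw [setIntegral_congr_fun measurableSet_Iic hg1, setIntegral_const,
      measureReal_expMeasure_Iic hr ha, smul_eq_mul]
  have hI3 : ∫ v in Ioi (a + c), g v ∂(expMeasure r) =
      Real.exp (-(r * (a + c))) * (lam ^ 2 - r * c) := by
    rw [setIntegral_congr_fun measurableSet_Ioi hg3, setIntegral_const, ← compl_Iic,
      probReal_compl_eq_one_sub measurableSet_Iic,
      measureReal_expMeasure_Iic hr (by linarith), smul_eq_mul]
    ring
  have hI2 : ∫ v in Ioc a (a + c), g v ∂(expMeasure r) =
      -Real.exp (-(r * (a + c))) * ((y - r * (a + c - a)) ^ 2 + (y - r * (a + c - a)) - y) -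
        -Real.exp (-(r * a)) * ((y - r * (a - a)) ^ 2 + (y - r * (a - a)) - y) := by
    rw [setIntegral_congr_fun measurableSet_Ioc hg2]
    -- With `z = y - r (v - a)` the integrand is `(z + 1) ^ 2 - (y - z)`, and `h = z ^ 2 + z - y`
    -- solves `h + h' = (z + 1) ^ 2 - (y - z)`. The boundary term at `z = -lam` cancels the tail
    -- integral.
    refine setIntegral_expMeasure_Ioc (F := fun v =>
      -Real.exp (-(r * v)) * ((y - r * (v - a)) ^ 2 + (y - r * (v - a)) - y))
      hr ha (by linarith) (by fun_prop) fun v => ?_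
    have h1 := hasDerivAt_neg_exp_mul_exp (r := r) (x := v)
    have h2 : HasDerivAt (fun v => y - r * (v - a)) (-r) v := by
      simpa using (((hasDerivAt_id v).sub_const a).const_mul r).const_sub y
    convert! h1.mul (((h2.pow 2).add h2).sub_const y) using 1
    simp
    ring
  have hsplit : ∫ v, g v ∂(expMeasure r) = (∫ v in Iic a, g v ∂(expMeasure r)) +
      ((∫ v in Ioc a (a + c), g v ∂(expMeasure r)) +
        ∫ v in Ioi (a + c), g v ∂(expMeasure r)) := by
    have hdisj : Disjoint (Ioc a (a + c)) (Ioi (a + c)) :=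
      Set.disjoint_left.2 fun v h1 h2 => absurd h1.2 (not_le.2 h2)
    rw [← setIntegral_union hdisj measurableSet_Ioi hgi.integrableOn hgi.integrableOn, Ioc_union_Ioi_eq_Ioi (by linarith),
      ← compl_Iic, integral_add_compl measurableSet_Iic hgi]
  rw [hsplit, hI1, hI2, hI3]
  have : r * (a + c - a) = y + lam := by rw [add_sub_cancel_left, hrc]
  rw [this, hrc]
  ring

theorem toReal_ofReal_sub_coe (v : ℝ) (a : ℝ≥0) :
    (ENNReal.ofReal v - a).toReal = max (v - a) 0 := by
  rw [← ENNReal.ofReal_coe_nnreal, ← ENNReal.ofReal_sub _ a.coe_nonneg, ENNReal.toReal_ofReal']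

/-- The value `α = ∞` is allowed: it encodes a job that never starts or is completed before the
message, with residual zero. -/
theorem lintegral_walkStep_sq {lam r : ℝ} (hlam : 0 < lam) (hr : 0 < r) (y : ℝ) (α : ℝ≥0∞) :
    ∫⁻ v, ENNReal.ofReal (walkStep lam r y (ENNReal.ofReal v - α).toReal ^ 2) ∂(expMeasure r) =
      ENNReal.ofReal (y ^ 2) + ENNReal.ofReal r *
        ∫⁻ v, ENNReal.ofReal (walkWork lam r y (ENNReal.ofReal v - α).toReal)
          ∂(expMeasure r) := by
  have hp := isProbabilityMeasure_expMeasure hr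
  by_cases hy : lam ≤ |y|
  · simp [walkStep, walkWork, hy]
  rcases eq_or_ne α ∞ with rfl | hα
  · have h0 : 0 ≤ (y + lam) / r := by
      have := (abs_lt.1 (not_le.1 hy)).1
      exact div_nonneg (by linarith) hr.le
    simp [walkStep, walkWork, hy, h0]
  obtain ⟨a, rfl⟩ := exists_coe_eq_of_ne_top hα
  simp only [toReal_ofReal_sub_coe]
  have h := integral_walkStep_sq hlam hr a.coe_nonneg (not_le.1 hy)
  have hm : Measurable fun v : ℝ => (y, max (v - (a : ℝ)) 0) := by fun_prop
  have hi1 : Integrable (fun v => walkStep lam r y (max (v - (a : ℝ)) 0) ^ 2) (expMeasure r) := by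
    refine Integrable.of_bound (C := (|y| + 1 + lam) ^ 2)
      (((measurable_walkStep lam r).comp hm).pow_const 2).aestronglyMeasurable
      (Filter.Eventually.of_forall fun v => ?_)
    have h1 := abs_walkStep_le (y := y) (w := max (v - (a : ℝ)) 0) hlam hr
    rw [Real.norm_eq_abs, abs_pow]
    gcongr
  have hi2 : Integrable (fun v => walkWork lam r y (max (v - (a : ℝ)) 0)) (expMeasure r) := by
    refine Integrable.of_bound (C := (y + lam) / r)
      ((measurable_walkWork lam r).comp hm).aestronglyMeasurable
      (Filter.Eventually.of_forall fun v => ?_)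
    rw [Real.norm_of_nonneg (walkWork_nonneg hr (le_max_right _ _)), walkWork, if_neg hy]
    exact min_le_right _ _
  rw [integral_sub hi1 (hi2.const_mul r), integral_const_mul] at h
  have hnn : 0 ≤ ∫ v, walkWork lam r y (max (v - (a : ℝ)) 0) ∂(expMeasure r) :=
    integral_nonneg fun v => walkWork_nonneg (lam := lam) hr (y := y) (le_max_right (v - (a : ℝ)) 0)
  rw [← ofReal_integral_eq_lintegral_ofReal hi1 (Filter.Eventually.of_forall fun _ => sq_nonneg _),
    ← ofReal_integral_eq_lintegral_ofReal hi2
      (Filter.Eventually.of_forall fun v => walkWork_nonneg hr (le_max_right _ _)),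
    ← ENNReal.ofReal_mul hr.le, ← ENNReal.ofReal_add (sq_nonneg _) (mul_nonneg hr.le hnn)]
  congr 1
  linarith

/-! ### Independence and second moments along the filtration indexed by jobs -/

section Filtration

variable {Ω : Type*}

/-- On the π-system of sets `E ∩ G` that generates `m₁ ⊔ m₂`, first split off `E` from `G ∩ H`, then
`G` from `H`. -/
theorem indep_sup_left {m₁ m₂ m₃ m₄ : MeasurableSpace Ω} {mΩ : MeasurableSpace Ω} {P : Measure Ω}
    [IsProbabilityMeasure P] (h₁ : m₁ ≤ mΩ) (h₂ : m₂ ≤ mΩ) (h₃ : m₃ ≤ mΩ)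
    (h₂₄ : m₂ ≤ m₄) (h₃₄ : m₃ ≤ m₄) (h : Indep m₁ m₄ P) (h' : Indep m₂ m₃ P) :
    Indep (m₁ ⊔ m₂) m₃ P := by
  set p : Set (Set Ω) := {s | ∃ E G, MeasurableSet[m₁] E ∧ MeasurableSet[m₂] G ∧ s = E ∩ G}
  have hp : m₁ ⊔ m₂ = MeasurableSpace.generateFrom p := by
    refine le_antisymm (sup_le (fun E hE => ?_) fun G hG => ?_)
      (MeasurableSpace.generateFrom_le ?_)
    · exact MeasurableSpace.measurableSet_generateFrom
        ⟨E, univ, hE, MeasurableSet.univ, by simp⟩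
    · exact MeasurableSpace.measurableSet_generateFrom
        ⟨univ, G, MeasurableSet.univ, hG, by simp⟩
    · rintro _ ⟨E, G, hE, hG, rfl⟩
      exact MeasurableSet.inter (le_sup_left (a := m₁) (b := m₂) _ hE)
        (le_sup_right (a := m₁) (b := m₂) _ hG)
  refine IndepSets.indep (p1 := p) (p2 := {s | MeasurableSet[m₃] s}) (sup_le h₁ h₂) h₃ ?_
    (@MeasurableSpace.isPiSystem_measurableSet Ω m₃) hp
    (@MeasurableSpace.generateFrom_measurableSet Ω m₃).symm ?_
  · rintro _ ⟨E, G, hE, hG, rfl⟩ _ ⟨E', G', hE', hG', rfl⟩ _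
    exact ⟨E ∩ E', G ∩ G', MeasurableSet.inter hE hE', MeasurableSet.inter hG hG',
      inter_inter_inter_comm _ _ _ _⟩
  · rw [IndepSets_iff]
    rintro _ H ⟨E, G, hE, hG, rfl⟩ hH
    rw [Indep_iff] at h h'
    rw [inter_assoc, h E (G ∩ H) hE (MeasurableSet.inter (h₂₄ _ hG) (h₃₄ _ hH)),
      h' G H hG hH, h E G hE (h₂₄ _ hG), mul_assoc]

theorem infoUpTo_mono (𝓔 : MeasurableSpace Ω) (V : ℕ → Ω → ℝ) : Monotone (infoUpTo 𝓔 V) :=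
  fun _ _ h => sup_le_sup le_rfl (biSup_mono fun _ hl => hl.trans_le h)

theorem measurable_infoUpTo (𝓔 : MeasurableSpace Ω) (V : ℕ → Ω → ℝ) (l : ℕ) :
    Measurable[infoUpTo 𝓔 V (l + 1)] (V l) := by
  have h : MeasurableSpace.comap (V l) inferInstance ≤ infoUpTo 𝓔 V (l + 1) :=
    le_sup_of_le_right (le_iSup₂_of_le l (Nat.lt_succ_self l) le_rfl)
  exact (comap_measurable (V l)).mono h le_rfl

theorem infoUpTo_le {𝓔 mΩ : MeasurableSpace Ω} (h𝓔 : 𝓔 ≤ mΩ) {V : ℕ → Ω → ℝ}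
    (hV : ∀ l, Measurable (V l)) (l : ℕ) : infoUpTo 𝓔 V l ≤ mΩ :=
  sup_le h𝓔 (iSup₂_le fun l _ => (hV l).comap_le)

theorem indep_infoUpTo {𝓔 mΩ : MeasurableSpace Ω} {P : Measure Ω} [IsProbabilityMeasure P]
    (h𝓔 : 𝓔 ≤ mΩ) {V : ℕ → Ω → ℝ} (hV : ∀ l, Measurable (V l)) (hV_indep : iIndepFun V P)
    (h𝓔_indep : Indep 𝓔 (⨆ l, MeasurableSpace.comap (V l) inferInstance) P) (l : ℕ) :
    Indep (infoUpTo 𝓔 V l) (MeasurableSpace.comap (V l) inferInstance) P := by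
  refine indep_sup_left h𝓔 (iSup₂_le fun l _ => (hV l).comap_le) (hV l).comap_le
    (iSup₂_le fun k _ => le_iSup (fun l => MeasurableSpace.comap (V l) inferInstance) k)
    (le_iSup (fun l => MeasurableSpace.comap (V l) inferInstance) l) h𝓔_indep ?_
  have h := indep_iSup_of_disjoint (fun l => (hV l).comap_le) hV_indep.iIndep
    (S := Iio l) (T := {l}) (by simp)
  simpa using h

theorem measurable_residual {𝓕 : ℕ → MeasurableSpace Ω} (h𝓕 : Monotone 𝓕) {V : ℕ → Ω → ℝ}
    (hV : ∀ l, Measurable[𝓕 (l + 1)] (V l)) {α : ℕ → Ω → ℝ≥0∞}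
    (hα : ∀ l, Measurable[𝓕 l] (α l)) {W : ℕ → Ω → ℝ}
    (hW : ∀ l ω, W l ω = (ENNReal.ofReal (V l ω) - α l ω).toReal) (l : ℕ) :
    Measurable[𝓕 (l + 1)] (W l) := by
  rw [show W l = fun ω => (ENNReal.ofReal (V l ω) - α l ω).toReal from funext (hW l)]
  exact ((ENNReal.measurable_ofReal.comp (hV l)).sub
    ((hα l).mono (h𝓕 (Nat.le_succ l)) le_rfl)).ennreal_toReal

theorem measurable_stoppedWalk {𝓕 : ℕ → MeasurableSpace Ω} (h𝓕 : Monotone 𝓕) {W : ℕ → Ω → ℝ}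
    (hW : ∀ l, Measurable[𝓕 (l + 1)] (W l)) {lam r : ℝ} (l : ℕ) :
    Measurable[𝓕 l] fun ω => stoppedWalk lam r (fun l => W l ω) l := by
  induction l with
  | zero => exact measurable_const
  | succ l ih =>
    exact (measurable_walkStep lam r).comp
      ((ih.mono (h𝓕 (Nat.le_succ l)) le_rfl).prodMk (hW l))

/-- Given `𝓕 n`, the walk and the service already received `α n` are fixed while `V n` is a fresh
exponential variable. Fubini integrates it out, and `lintegral_walkStep_sq` adds the expected work
on job `n`. -/
theorem lintegral_stoppedWalk_sq {mΩ : MeasurableSpace Ω} {P : Measure Ω} [IsProbabilityMeasure P]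
    {𝓕 : ℕ → MeasurableSpace Ω} (h𝓕 : Monotone 𝓕) (h𝓕' : ∀ l, 𝓕 l ≤ mΩ) {V : ℕ → Ω → ℝ}
    (hV : ∀ l, Measurable[𝓕 (l + 1)] (V l)) {lam r : ℝ} (hlam : 0 < lam) (hr : 0 < r)
    (hlaw : ∀ l, HasLaw (V l) (expMeasure r) P)
    (hind : ∀ l, Indep (𝓕 l) (MeasurableSpace.comap (V l) inferInstance) P)
    {α : ℕ → Ω → ℝ≥0∞} (hα : ∀ l, Measurable[𝓕 l] (α l)) {W : ℕ → Ω → ℝ}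
    (hW : ∀ l ω, W l ω = (ENNReal.ofReal (V l ω) - α l ω).toReal) (n : ℕ) :
    ∫⁻ ω, ENNReal.ofReal (stoppedWalk lam r (fun l => W l ω) n ^ 2) ∂P =
      ENNReal.ofReal r * ∫⁻ ω, ∑ l ∈ Finset.range n, ENNReal.ofReal
        (walkWork lam r (stoppedWalk lam r (fun l => W l ω) l) (W l ω)) ∂P := by
  have hWm := fun l => measurable_residual h𝓕 hV hα hW l
  have hym := fun l => measurable_stoppedWalk (lam := lam) (r := r) h𝓕 hWm l
  have hworkm : ∀ l, Measurable fun ω => ENNReal.ofReal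
      (walkWork lam r (stoppedWalk lam r (fun l => W l ω) l) (W l ω)) := fun l =>
    ENNReal.measurable_ofReal.comp ((measurable_walkWork lam r).comp
      (((hym l).mono (h𝓕' _) le_rfl).prodMk ((hWm l).mono (h𝓕' _) le_rfl)))
  induction n with
  | zero => simp [stoppedWalk]
  | succ n ih =>
    have hVn : Measurable (V n) := (hV n).mono (h𝓕' _) le_rfl
    set U : Ω → ℝ × ℝ≥0∞ := fun ω => (stoppedWalk lam r (fun l => W l ω) n, α n ω) with hU
    have hUm' : Measurable[𝓕 n] U := (hym n).prodMk (hα n)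
    have hUm : Measurable U := hUm'.mono (h𝓕' _) le_rfl
    have hUV : IndepFun U (V n) P :=
      indep_of_indep_of_le_left (hind n) hUm'.comap_le
    have hmap := (indepFun_iff_map_prod_eq_prod_map_map hUm.aemeasurable hVn.aemeasurable).1 hUV
    have hp := isProbabilityMeasure_expMeasure hr
    rw [(hlaw n).map_eq] at hmap
    have key : ∀ Φ : (ℝ × ℝ≥0∞) × ℝ → ℝ≥0∞, Measurable Φ →
        ∫⁻ ω, Φ (U ω, V n ω) ∂P = ∫⁻ ω, ∫⁻ v, Φ (U ω, v) ∂(expMeasure r) ∂P := by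
      intro Φ hΦ
      rw [← lintegral_map hΦ (hUm.prodMk hVn), hmap, lintegral_prod _ hΦ.aemeasurable,
        lintegral_map hΦ.lintegral_prod_right' hUm]
    have hm : Measurable fun p : (ℝ × ℝ≥0∞) × ℝ =>
        (p.1.1, (ENNReal.ofReal p.2 - p.1.2).toReal) := by fun_prop
    have h1 := key (fun p => ENNReal.ofReal
      (walkStep lam r p.1.1 (ENNReal.ofReal p.2 - p.1.2).toReal ^ 2))
      (ENNReal.measurable_ofReal.comp (((measurable_walkStep lam r).comp hm).pow_const 2))
    have hΦ : Measurable fun p : (ℝ × ℝ≥0∞) × ℝ => ENNReal.ofReal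
      (walkWork lam r p.1.1 (ENNReal.ofReal p.2 - p.1.2).toReal) :=
      (ENNReal.measurable_ofReal.comp ((measurable_walkWork lam r).comp hm))
    have h2 := key _ hΦ
    simp only [hU, ← hW] at h1 h2
    simp only [stoppedWalk]
    rw [h1]
    simp only [lintegral_walkStep_sq hlam hr]
    have hy2 : Measurable fun ω => ENNReal.ofReal (stoppedWalk lam r (fun l => W l ω) n ^ 2) :=
      ENNReal.measurable_ofReal.comp (((hym n).mono (h𝓕' _) le_rfl).pow_const 2)
    have hwork : Measurable fun ω => ∫⁻ v, ENNReal.ofReal (walkWork lam r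
        (stoppedWalk lam r (fun l => W l ω) n) (ENNReal.ofReal v - α n ω).toReal)
          ∂(expMeasure r) := hΦ.lintegral_prod_right'.comp hUm
    rw [lintegral_add_left hy2, lintegral_const_mul _ hwork, ← h2, ih, ← mul_add]
    congr 1
    rw [← lintegral_add_left (Finset.measurable_fun_sum _ fun l _ => hworkm l)]
    simp only [Finset.sum_range_succ]

end Filtration

/-! ### Causality: predictable service starts and the history of the server -/

section Causal

variable {Ω : Type*} {mΩ : MeasurableSpace Ω}

/-- The events that, when `N = l`, are decided up to null sets by the information `𝓕 l`. -/
@[reducible] def observed (P : Measure Ω) (𝓕 : ℕ → MeasurableSpace Ω) (N : Ω → ℕ) : MeasurableSpace Ω where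
  MeasurableSet' E := ∀ l, ∃ G, MeasurableSet[𝓕 l] G ∧ ∀ᵐ ω ∂P, N ω = l → (ω ∈ E ↔ ω ∈ G)
  measurableSet_empty l := ⟨∅, @MeasurableSet.empty _ (𝓕 l), by simp⟩
  measurableSet_compl E hE l := by
    obtain ⟨G, hG, h⟩ := hE l
    refine ⟨Gᶜ, MeasurableSet.compl hG, ?_⟩
    filter_upwards [h] with ω h hl
    simp [h hl]
  measurableSet_iUnion E hE l := by
    choose G hG h using fun n => hE n l
    refine ⟨⋃ n, G n, MeasurableSet.iUnion hG, ?_⟩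
    filter_upwards [ae_all_iff.2 h] with ω h hl
    simp [h _ hl]

/-- A random FIFO queue with causal arrivals: `𝓕 l` is the information available before the
requirement of job `l` is revealed. -/
structure IsCausal (P : Measure Ω) (𝓕 : ℕ → MeasurableSpace Ω) (q : Ω → ℕ) (A : ℝ≥0 → Ω → ℕ)
    (V : ℕ → Ω → ℝ) : Prop where
  mono : Monotone 𝓕
  le : ∀ l, 𝓕 l ≤ mΩ
  path : ∀ ω, IsCountingPath fun t => A t ω
  measurable_init : Measurable[𝓕 0] q
  measurable_requirement : ∀ l, Measurable[𝓕 (l + 1)] (V l)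
  pos : ∀ᵐ ω ∂P, ∀ l, 0 < V l ω
  arrivals : ∀ (t : ℝ≥0) (n : ℕ), ∃ f : Ω → ℕ, Measurable[𝓕 n] f ∧
    ∀ᵐ ω ∂P, departures (q ω) (fun s => A s ω) (fun l => V l ω) t = n → A t ω = f ω

variable {P : Measure Ω} {𝓕 : ℕ → MeasurableSpace Ω} {q : Ω → ℕ} {A : ℝ≥0 → Ω → ℕ}
  {V : ℕ → Ω → ℝ}

/-- If it is observed whether the random time `R` has come, then `R` is determined before the
completion of job `l` by the information available before the requirement of this job is
revealed. -/
theorem IsCausal.exists_predictable (H : IsCausal P 𝓕 q A V) {l : ℕ} {c : Ω → ℝ≥0∞}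
    (hc : Measurable[𝓕 l] c)
    (hc' : ∀ᵐ ω ∂P, prevCompletion (q ω) (fun s => A s ω) (fun l => V l ω) l = c ω)
    {R : Ω → ℝ≥0∞} (hR : ∀ t : ℝ≥0, ∃ G, MeasurableSet[𝓕 l] G ∧ ∀ᵐ ω ∂P,
      departures (q ω) (fun s => A s ω) (fun l => V l ω) t = l → (R ω ≤ t ↔ ω ∈ G)) :
    ∃ ρ : Ω → ℝ≥0∞, Measurable[𝓕 l] ρ ∧ ∀ᵐ ω ∂P,
      min (max (R ω) (prevCompletion (q ω) (fun s => A s ω) (fun l => V l ω) l))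
          (completionTime (q ω) (fun s => A s ω) (fun l => V l ω) l) =
        min (ρ ω) (completionTime (q ω) (fun s => A s ω) (fun l => V l ω) l) := by
  classical
  set u : ℕ → ℝ≥0 := TopologicalSpace.denseSeq ℝ≥0 with hu
  choose G hG h using fun n => hR (u n)
  -- While `l` jobs have been completed, `R ≤ t` is decided by an event of `𝓕 l`. Testing a dense
  -- sequence of times after the previous completion recovers `R` as an infimum, with only countably
  -- many null sets discarded.
  refine ⟨fun ω => ⨅ n, if c ω ≤ u n ∧ ω ∈ G n then (u n : ℝ≥0∞) else ⊤,
    Measurable.iInf fun n => Measurable.ite ?_ measurable_const measurable_const, ?_⟩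
  · exact (measurableSet_le hc measurable_const).inter (hG n)
  filter_upwards [hc', ae_all_iff.2 h] with ω hcω hω
  set a : ℝ≥0 → ℕ := fun s => A s ω
  set p := prevCompletion (q ω) a (fun l => V l ω) l
  set C := completionTime (q ω) a (fun l => V l ω) l
  have hω' : ∀ n, p ≤ u n → u n < C → (R ω ≤ u n ↔ ω ∈ G n) := fun n h1 h2 =>
    hω n ((departures_eq_iff (H.path ω)).2 ⟨h1, h2⟩)
  rw [← hcω]
  refine le_antisymm (le_min (le_iInf fun n => ?_) (min_le_right _ _)) ?_
  · split_ifs with hn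
    · rcases lt_or_ge (u n : ℝ≥0∞) C with h1 | h1
      · exact (min_le_left _ _).trans (max_le ((hω' n hn.1 h1).2 hn.2) hn.1)
      · exact (min_le_right _ _).trans h1
    · exact le_top
  · rcases lt_or_ge (max (R ω) p) C with h1 | h1
    · rw [min_eq_left h1.le]
      refine le_of_forall_gt fun b hb => ?_
      obtain ⟨b₁, hb₁, hb₁'⟩ := ENNReal.lt_iff_exists_nnreal_btwn.1 (lt_min hb h1)
      obtain ⟨b₂, hb₂, hb₂'⟩ := ENNReal.lt_iff_exists_nnreal_btwn.1 hb₁'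
      obtain ⟨_, ⟨n, rfl⟩, hn1, hn2⟩ := (TopologicalSpace.denseRange_denseSeq ℝ≥0).exists_between
        (show b₁ < b₂ by exact_mod_cast hb₂)
      have h2 : max (R ω) p < u n := hb₁.trans (by exact_mod_cast hn1)
      have h3 : (u n : ℝ≥0∞) < min b C := lt_trans (by exact_mod_cast hn2) hb₂'
      have h4 : p ≤ u n := (le_max_right _ _).trans h2.le
      refine (min_le_left _ _).trans_lt ((iInf_le _ n).trans_lt ?_)
      rw [if_pos ⟨h4, (hω' n h4 (h3.trans_le (min_le_right _ _))).1
        ((le_max_left _ _).trans h2.le)⟩]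
      exact h3.trans_le (min_le_left _ _)
    · rw [min_eq_right h1]
      exact min_le_right _ _

theorem IsCausal.exists_serviceStart (H : IsCausal P 𝓕 q A V) {l : ℕ} {c : Ω → ℝ≥0∞}
    (hc : Measurable[𝓕 l] c)
    (hc' : ∀ᵐ ω ∂P, prevCompletion (q ω) (fun s => A s ω) (fun l => V l ω) l = c ω) :
    ∃ b : Ω → ℝ≥0∞, Measurable[𝓕 l] b ∧ ∀ᵐ ω ∂P,
      serviceStart (q ω) (fun s => A s ω) (fun l => V l ω) l = b ω := by
  obtain ⟨ρ, hρ, h⟩ := H.exists_predictable hc hc'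
    (R := fun ω => arrivalEpoch (q ω) (fun s => A s ω) l) fun t => by
      obtain ⟨f, hf, h⟩ := H.arrivals t l
      refine ⟨{ω | l < q ω + f ω}, ?_, ?_⟩
      · exact measurableSet_lt measurable_const
          ((H.measurable_init.mono (H.mono (Nat.zero_le l)) le_rfl).add hf)
      · filter_upwards [h] with ω h hl
        rw [(H.path ω).arrivalEpoch_le_iff, h hl]
  refine ⟨ρ, hρ, ?_⟩
  filter_upwards [h, H.pos] with ω h hv
  change min (serviceStart (q ω) (fun s => A s ω) (fun l => V l ω) l) _ = _ at h
  rw [completionTime_eq_serviceStart_add] at h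
  set b := serviceStart (q ω) (fun s => A s ω) (fun l => V l ω) l
  rw [min_eq_left le_self_add] at h
  rcases eq_or_ne b ∞ with hb | hb
  · rw [hb] at h ⊢
    simpa using h
  · have h1 : b < b + ENNReal.ofReal (V l ω) := ENNReal.lt_add_right hb (by simpa using hv l)
    rcases min_choice (ρ ω) (b + ENNReal.ofReal (V l ω)) with h2 | h2
    · rw [h2] at h; exact h
    · rw [h2] at h; exact absurd h h1.ne

/-- The induction alternates: the previous completion makes the arrival of job `l` predictable,
hence its service start, and adding `V l` gives the next completion one level up in the filtration.
-/
theorem IsCausal.exists_prevCompletion (H : IsCausal P 𝓕 q A V) (l : ℕ) :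
    ∃ c : Ω → ℝ≥0∞, Measurable[𝓕 l] c ∧ ∀ᵐ ω ∂P,
      prevCompletion (q ω) (fun s => A s ω) (fun l => V l ω) l = c ω := by
  induction l with
  | zero => exact ⟨fun _ => 0, measurable_const, by simp [prevCompletion]⟩
  | succ l ih =>
    obtain ⟨c, hc, hc'⟩ := ih
    obtain ⟨b, hb, hb'⟩ := H.exists_serviceStart hc hc'
    refine ⟨fun ω => b ω + ENNReal.ofReal (V l ω), (hb.mono (H.mono (Nat.le_succ l)) le_rfl).add
      (ENNReal.measurable_ofReal.comp (H.measurable_requirement l)), ?_⟩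
    filter_upwards [hb'] with ω h
    rw [prevCompletion, completionTime_eq_serviceStart_add, h]

/-- The information available at time `t`. -/
abbrev history (P : Measure Ω) (𝓕 : ℕ → MeasurableSpace Ω) (q : Ω → ℕ) (A : ℝ≥0 → Ω → ℕ)
    (V : ℕ → Ω → ℝ) (t : ℝ≥0) : MeasurableSpace Ω :=
  observed P 𝓕 fun ω => departures (q ω) (fun s => A s ω) (fun l => V l ω) t

theorem IsCausal.exists_le_departures (H : IsCausal P 𝓕 q A V) (s : ℝ≥0) (k : ℕ) :
    ∃ G, MeasurableSet[𝓕 k] G ∧ ∀ᵐ ω ∂P,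
      k ≤ departures (q ω) (fun s => A s ω) (fun l => V l ω) s ↔ ω ∈ G := by
  obtain ⟨c, hc, hc'⟩ := H.exists_prevCompletion k
  refine ⟨{ω | c ω ≤ s}, measurableSet_le hc measurable_const, ?_⟩
  filter_upwards [hc'] with ω h
  rw [le_departures_iff (H.path ω), h]

theorem IsCausal.measurable_departures (H : IsCausal P 𝓕 q A V) {s t : ℝ≥0} (hst : s ≤ t) :
    Measurable[history P 𝓕 q A V t]
      fun ω => departures (q ω) (fun s => A s ω) (fun l => V l ω) s := by
  refine @measurable_of_Ici ℕ Ω _ _ _ (history P 𝓕 q A V t) _ _ _ _ fun k => ?_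
  intro l
  rcases le_or_gt k l with hkl | hkl
  · obtain ⟨G, hG, h⟩ := H.exists_le_departures s k
    refine ⟨G, H.mono hkl _ hG, ?_⟩
    filter_upwards [h] with ω h _
    exact h
  · refine ⟨∅, @MeasurableSet.empty _ (𝓕 l), Filter.Eventually.of_forall fun ω hω => ?_⟩
    have hω : departures (q ω) (fun s => A s ω) (fun l => V l ω) t = l := hω
    have := departures_mono (q := q ω) (v := fun l => V l ω) (H.path ω) hst
    simp only [mem_preimage, mem_Ici, mem_empty_iff_false, iff_false]
    omega

/-- If `l` jobs are completed by `t`, then some `k ≤ l` are completed by `s`. The event is decided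
by `𝓕 k ≤ 𝓕 l`, and the value of `k` is itself decided by `𝓕 l`. -/
theorem IsCausal.history_mono (H : IsCausal P 𝓕 q A V) : Monotone (history P 𝓕 q A V) := by
  intro s t hst E hE l
  choose G hG h using hE
  choose K hK h' using fun k => H.measurable_departures hst (measurableSet_singleton k) l
  refine ⟨⋃ k ∈ Finset.range (l + 1), G k ∩ K k, ?_, ?_⟩
  · exact Finset.measurableSet_biUnion _ fun k hk =>
      MeasurableSet.inter (H.mono (Nat.lt_succ_iff.1 (Finset.mem_range.1 hk)) _ (hG k)) (hK k)
  · filter_upwards [ae_all_iff.2 h, ae_all_iff.2 h'] with ω h h' hl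
    have hm := departures_mono (q := q ω) (v := fun l => V l ω) (H.path ω) hst
    rw [h _ rfl]
    simp only [mem_iUnion, Finset.mem_range, mem_inter_iff, exists_prop, ← h' _ hl, mem_preimage,
      mem_singleton_iff]
    constructor
    · exact fun h1 => ⟨_, by omega, h1, rfl⟩
    · rintro ⟨k, _, h1, rfl⟩
      exact h1

theorem IsCausal.measurable_arrivals (H : IsCausal P 𝓕 q A V) (t : ℝ≥0) :
    Measurable[history P 𝓕 q A V t] (A t) := by
  intro S hS l
  obtain ⟨f, hf, h⟩ := H.arrivals t l
  refine ⟨f ⁻¹' S, hf hS, ?_⟩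
  filter_upwards [h] with ω h hl
  rw [mem_preimage, mem_preimage, h hl]

theorem IsCausal.measurable_init_history (H : IsCausal P 𝓕 q A V) (t : ℝ≥0) :
    Measurable[history P 𝓕 q A V t] q := fun S hS l =>
  ⟨q ⁻¹' S, H.mono (Nat.zero_le l) _ (H.measurable_init hS), by simp⟩

theorem IsCausal.nullMeasurableSet (H : IsCausal P 𝓕 q A V) {t : ℝ≥0} {E : Set Ω}
    (hE : MeasurableSet[history P 𝓕 q A V t] E) : NullMeasurableSet E P := by
  choose G hG h using hE
  choose K hK h' using H.exists_le_departures t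
  refine NullMeasurableSet.congr (s := ⋃ l, G l ∩ (K l \ K (l + 1))) ?_ ?_
  · exact (MeasurableSet.iUnion fun l => (H.le _ _ (hG l)).inter
      ((H.le _ _ (hK l)).diff (H.le _ _ (hK _)))).nullMeasurableSet
  · rw [Filter.eventuallyEq_set]
    filter_upwards [ae_all_iff.2 h, ae_all_iff.2 h'] with ω h h'
    simp only [mem_iUnion, mem_inter_iff, mem_sdiff, ← h']
    constructor
    · rintro ⟨l, h1, h2, h3⟩
      exact (h l (by omega)).2 h1
    · exact fun h1 => ⟨_, (h _ rfl).1 h1, le_rfl, by omega⟩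

end Causal

/-! ### Messaging times are stopping times -/

/-- Unrolling the maximum turns the emulated count into finitely many conditions on arrivals at
deterministic times not later than `t`, which the history at `t` decides. -/
theorem lt_emulatedDepartures_iff_forall {q : ℕ} {a : ℝ≥0 → ℕ} {v : ℕ → ℝ} {r : ℝ}
    (ha : IsCountingPath a) (hr : 0 < r) {s t : ℝ≥0} (hst : s ≤ t) {l : ℕ} :
    l < emulatedDepartures r q a v s t ↔ ∀ j ≤ l,
      Real.toNNReal (((l : ℝ) + 1 - j) * (1 / r)) ≤ t ∧
      s ≤ t - Real.toNNReal (((l : ℝ) + 1 - j) * (1 / r)) ∧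
      departures q a v s + j < q + a (t - Real.toNNReal (((l : ℝ) + 1 - j) * (1 / r))) := by
  rw [lt_emulatedDepartures_iff ha hst, lindley_le_iff]
  refine forall₂_congr fun j hj => ?_
  rw [sum_Icc_ofReal_const (by positivity) hj, ENNReal.ofReal]
  set δ := Real.toNNReal (((l : ℝ) + 1 - j) * (1 / r))
  rcases le_or_gt δ t with h | h
  · have h1 : (δ : ℝ≥0∞) ≤ t := by exact_mod_cast h
    rw [← ENNReal.le_sub_iff_add_le_right (by simp) h1, ← ENNReal.coe_sub, emulatedEpoch,
      max_le_iff, ha.arrivalEpoch_le_iff, ENNReal.coe_le_coe]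
    tauto
  · have h1 : ¬ (δ : ℝ≥0∞) ≤ t := by exact_mod_cast h.not_ge
    simp only [h.not_ge, false_and, iff_false]
    exact fun h2 => h1 (le_add_self.trans h2)

section Stopping

variable {Ω : Type*} {mΩ : MeasurableSpace Ω} {P : Measure Ω} {𝓕 : ℕ → MeasurableSpace Ω}
  {q : Ω → ℕ} {A : ℝ≥0 → Ω → ℕ} {V : ℕ → Ω → ℝ} {r : ℝ} {x : ℕ}

theorem IsCausal.measurableSet_departures_stopped (H : IsCausal P 𝓕 q A V) {S : Ω → ℝ≥0∞}
    (hS : ∀ t : ℝ≥0, MeasurableSet[history P 𝓕 q A V t] {ω | S ω ≤ t}) (t : ℝ≥0) (d : ℕ) :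
    MeasurableSet[history P 𝓕 q A V t] {ω | S ω ≤ t ∧
      departures (q ω) (fun s => A s ω) (fun l => V l ω) (S ω).toNNReal = d} := by
  set u : ℕ → ℝ≥0 := TopologicalSpace.denseSeq ℝ≥0 with hu
  have hle : ∀ d, MeasurableSet[history P 𝓕 q A V t] {ω | S ω ≤ t ∧
      departures (q ω) (fun s => A s ω) (fun l => V l ω) (S ω).toNNReal ≤ d} := by
    intro d
    have h1 : ∀ w ≤ t, MeasurableSet[history P 𝓕 q A V t] {ω | S ω ≤ w ∧
        departures (q ω) (fun s => A s ω) (fun l => V l ω) w ≤ d} := fun w hw =>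
      MeasurableSet.inter (H.history_mono hw _ (hS w))
        (measurableSet_le (H.measurable_departures hw) measurable_const)
    have h2 : {ω | S ω ≤ t ∧
        departures (q ω) (fun s => A s ω) (fun l => V l ω) (S ω).toNNReal ≤ d} =
        -- Departures are monotone and right-continuous, so the value at the random time `S` is at
        -- most `d` exactly when it is so at `t` or at some dense time in `[S, t]`.
        {ω | S ω ≤ t ∧ departures (q ω) (fun s => A s ω) (fun l => V l ω) t ≤ d} ∪
        ⋃ (n : ℕ) (_ : u n ≤ t), {ω | S ω ≤ u n ∧
          departures (q ω) (fun s => A s ω) (fun l => V l ω) (u n) ≤ d} := by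
      ext ω
      simp only [mem_ofPred_eq, mem_union, mem_iUnion, exists_prop]
      constructor
      · rintro ⟨h1, h2⟩
        obtain ⟨s, hs⟩ := exists_coe_eq_of_ne_top (ne_top_of_le_ne_top ENNReal.coe_ne_top h1)
        rw [← hs, ENNReal.toNNReal_coe] at h2
        rw [← hs] at h1 ⊢
        have hst : s ≤ t := by exact_mod_cast h1
        rcases hst.eq_or_lt with rfl | hst
        · exact .inl ⟨le_rfl, h2⟩
        obtain ⟨b, hb, h⟩ := departures_eventually_eq (q := q ω) (v := fun l => V l ω)
          (H.path ω) s
        obtain ⟨_, ⟨n, rfl⟩, hn1, hn2⟩ :=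
          (TopologicalSpace.denseRange_denseSeq ℝ≥0).exists_between (lt_min hb hst)
        refine .inr ⟨n, (hn2.trans_le (min_le_right _ _)).le, by exact_mod_cast hn1.le, ?_⟩
        rw [hu, h _ hn1.le (hn2.trans_le (min_le_left _ _))]
        exact h2
      · have hmono : ∀ w : ℝ≥0, S ω ≤ w →
            departures (q ω) (fun s => A s ω) (fun l => V l ω) w ≤ d →
            departures (q ω) (fun s => A s ω) (fun l => V l ω) (S ω).toNNReal ≤ d :=
          fun w h1 h2 => (departures_mono (H.path ω) (by
            simpa using ENNReal.toNNReal_mono ENNReal.coe_ne_top h1)).trans h2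
        rintro (⟨h1, h2⟩ | ⟨n, h0, h1, h2⟩)
        · exact ⟨h1, hmono _ h1 h2⟩
        · exact ⟨h1.trans (by exact_mod_cast h0), hmono _ h1 h2⟩
    rw [h2]
    exact MeasurableSet.union (h1 t le_rfl)
      (MeasurableSet.iUnion fun n => MeasurableSet.iUnion fun hn => h1 _ hn)
  rcases Nat.eq_zero_or_pos d with rfl | hd
  · simpa using hle 0
  · convert MeasurableSet.diff (hle d) (hle (d - 1)) using 1
    ext ω
    simp only [mem_ofPred_eq, mem_sdiff]
    grind

theorem IsCausal.measurableSet_emulationError (H : IsCausal P 𝓕 q A V) (hr : 0 < r)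
    {S : Ω → ℝ≥0∞} (hS : ∀ t : ℝ≥0, MeasurableSet[history P 𝓕 q A V t] {ω | S ω ≤ t})
    (t : ℝ≥0) :
    MeasurableSet[history P 𝓕 q A V t] {ω | S ω ≤ t ∧
      emulationError r (q ω) (fun s => A s ω) (fun l => V l ω) (S ω).toNNReal t = x} := by
  have hst : ∀ ω, S ω ≤ t → (S ω).toNNReal ≤ t := fun ω h => by
    simpa using ENNReal.toNNReal_mono ENNReal.coe_ne_top h
  set N : Ω → ℕ := fun ω =>
    emulatedDepartures r (q ω) (fun s => A s ω) (fun l => V l ω) (S ω).toNNReal t with hN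
  set J : ℕ → Set Ω := fun d => {ω | S ω ≤ t ∧
      departures (q ω) (fun s => A s ω) (fun l => V l ω) (S ω).toNNReal = d} with hJ
  have hJm : ∀ d, MeasurableSet[history P 𝓕 q A V t] (J d) :=
    H.measurableSet_departures_stopped hS t
  have hlt : ∀ d l, MeasurableSet[history P 𝓕 q A V t] (J d ∩ {ω | l < N ω}) := by
    intro d l
    set δ : ℕ → ℝ≥0 := fun j => Real.toNNReal (((l : ℝ) + 1 - j) * (1 / r)) with hδ
    have h1 : J d ∩ {ω | l < N ω} = J d ∩ ⋂ j ∈ Finset.range (l + 1),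
        {ω | δ j ≤ t ∧ S ω ≤ (t - δ j : ℝ≥0) ∧ d + j < q ω + A (t - δ j) ω} := by
      ext ω
      simp only [mem_inter_iff, mem_ofPred_eq, mem_iInter, Finset.mem_range, Nat.lt_succ_iff]
      refine and_congr_right fun hω => ?_
      obtain ⟨s, hs⟩ := exists_coe_eq_of_ne_top (ne_top_of_le_ne_top ENNReal.coe_ne_top hω.1)
      rw [hN, lt_emulatedDepartures_iff_forall (H.path ω) hr (hst ω hω.1)]
      refine forall₂_congr fun j _ => ?_
      rw [hω.2, ← hs, ENNReal.toNNReal_coe, ENNReal.coe_le_coe]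
    rw [h1]
    refine MeasurableSet.inter (hJm d) (Finset.measurableSet_biInter _ fun j _ => ?_)
    by_cases hj : δ j ≤ t
    · simp only [hj, true_and]
      have hle := H.history_mono (tsub_le_self : t - δ j ≤ t)
      exact MeasurableSet.inter (hle _ (hS _)) (measurableSet_lt measurable_const
        ((H.measurable_init_history t).add ((H.measurable_arrivals _).mono hle le_rfl)))
    · simp only [hj, false_and, ofPred_false]
      exact @MeasurableSet.empty _ (history P 𝓕 q A V t)
  have heq : ∀ d k, MeasurableSet[history P 𝓕 q A V t] (J d ∩ {ω | N ω = k}) := by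
    intro d k
    rcases Nat.eq_zero_or_pos k with rfl | hk
    · convert MeasurableSet.diff (hJm d) (hlt d 0) using 1
      ext ω
      simp only [mem_inter_iff, mem_ofPred_eq, mem_sdiff]
      grind
    · convert MeasurableSet.diff (hlt d (k - 1)) (hlt d k) using 1
      ext ω
      simp only [mem_inter_iff, mem_ofPred_eq, mem_sdiff]
      grind
  have hD := H.measurable_departures (le_refl t)
  have hfin : {ω | S ω ≤ t ∧
      emulationError r (q ω) (fun s => A s ω) (fun l => V l ω) (S ω).toNNReal t = x} =
      ⋃ (d : ℕ) (k : ℕ), (J d ∩ {ω | N ω = k}) ∩ {ω | ((k : ℤ) + d -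
        departures (q ω) (fun s => A s ω) (fun l => V l ω) t).natAbs = x} := by
    ext ω
    simp only [mem_ofPred_eq, mem_iUnion, mem_inter_iff, hJ]
    constructor
    · rintro ⟨h1, h2⟩
      rw [emulationError_eq (H.path ω) (hst ω h1)] at h2
      exact ⟨_, _, ⟨⟨h1, rfl⟩, rfl⟩, h2⟩
    · rintro ⟨d, k, ⟨⟨h1, rfl⟩, rfl⟩, h2⟩
      exact ⟨h1, by rw [emulationError_eq (H.path ω) (hst ω h1)]; exact h2⟩
  rw [hfin]
  refine MeasurableSet.iUnion fun d => MeasurableSet.iUnion fun k =>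
    MeasurableSet.inter (heq d k) ?_
  exact hD (MeasurableSet.of_discrete (s := {n : ℕ | ((k : ℤ) + d - n).natAbs = x}))

/-- The message time is attained and the error stays equal to `x` for a while after it, so a dense
sequence of times together with `t` detects it. -/
theorem IsCausal.measurableSet_messageTime_le (H : IsCausal P 𝓕 q A V) (hr : 0 < r) (m : ℕ) :
    ∀ t : ℝ≥0, MeasurableSet[history P 𝓕 q A V t]
      {ω | messageTime x r (q ω) (fun s => A s ω) (fun l => V l ω) m ≤ t} := by
  induction m with
  | zero => intro t; simp [messageTime]
  | succ m ih =>
    intro t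
    set u : ℕ → ℝ≥0 := TopologicalSpace.denseSeq ℝ≥0 with hu
    set S : Ω → ℝ≥0∞ := fun ω =>
      messageTime x r (q ω) (fun s => A s ω) (fun l => V l ω) m with hS
    set Z : ℝ≥0 → Set Ω := fun w => {ω | S ω ≤ w ∧
      emulationError r (q ω) (fun s => A s ω) (fun l => V l ω) (S ω).toNNReal w = x} with hZ
    have hZm : ∀ w ≤ t, MeasurableSet[history P 𝓕 q A V t] (Z w) := fun w hw =>
      H.history_mono hw _ (H.measurableSet_emulationError hr ih w)
    have h : {ω | messageTime x r (q ω) (fun s => A s ω) (fun l => V l ω) (m + 1) ≤ t} =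
        Z t ∪ ⋃ (n : ℕ) (_ : u n ≤ t), Z (u n) := by
      ext ω
      simp only [mem_ofPred_eq, mem_union, mem_iUnion, exists_prop]
      constructor
      · intro h1
        obtain ⟨b, hb⟩ := exists_coe_eq_of_ne_top (ne_top_of_le_ne_top ENNReal.coe_ne_top h1)
        obtain ⟨s, hs⟩ := exists_coe_eq_of_ne_top (b := S ω) (ne_top_of_le_ne_top
          (by rw [← hb]; simp) (messageTime_le_succ m))
        obtain ⟨hsb, herr⟩ := emulationError_messageTime (H.path ω) hs.symm hb.symm
        have hbt : b ≤ t := by rw [← hb] at h1; exact_mod_cast h1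
        have hmem : ∀ w, s ≤ w →
            emulationError r (q ω) (fun s => A s ω) (fun l => V l ω) s w = x → ω ∈ Z w :=
          fun w h2 h3 => ⟨by rw [← hs]; exact_mod_cast h2,
            by rw [← hs, ENNReal.toNNReal_coe]; exact h3⟩
        rcases hbt.eq_or_lt with rfl | hbt
        · exact .inl (hmem _ hsb herr)
        obtain ⟨c, hc, h⟩ := emulationError_eventually_eq (r := r) (q := q ω)
          (v := fun l => V l ω) (H.path ω) hsb
        obtain ⟨_, ⟨n, rfl⟩, hn1, hn2⟩ :=
          (TopologicalSpace.denseRange_denseSeq ℝ≥0).exists_between (lt_min hc hbt)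
        refine .inr ⟨n, (hn2.trans_le (min_le_right _ _)).le, hmem _ (hsb.trans hn1.le) ?_⟩
        rw [hu, h _ hn1.le (hn2.trans_le (min_le_left _ _)), herr]
      · have hle : ∀ w, ω ∈ Z w →
            messageTime x r (q ω) (fun s => A s ω) (fun l => V l ω) (m + 1) ≤ w :=
          fun w hw => iInf₂_le w hw
        rintro (h1 | ⟨n, hn, h1⟩)
        · exact hle t h1
        · exact (hle _ h1).trans (by exact_mod_cast hn)
    rw [h]
    exact MeasurableSet.union (hZm t le_rfl)
      (MeasurableSet.iUnion fun n => MeasurableSet.iUnion fun hn => hZm _ hn)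

end Stopping

/-! ### Residual requirements from the predictable version of the message time -/

section Residual

variable {q : ℕ} {a : ℝ≥0 → ℕ} {v : ℕ → ℝ}

open Classical in
/-- The service received by job `l` before time `ρ` (`∞` if the service never starts). -/
def serviceBefore (b ρ : ℝ≥0∞) : ℝ≥0∞ := if b = ∞ then ∞ else ρ - b

theorem residual_eq_zero {l : ℕ} {S ρ : ℝ≥0∞}
    (h : min (max S (prevCompletion q a v l)) (completionTime q a v l) =
      min ρ (completionTime q a v l)) (hS : completionTime q a v l ≤ S) :
    (ENNReal.ofReal (v l) - serviceBefore (serviceStart q a v l) ρ).toReal = 0 := by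
  rw [min_eq_right (hS.trans (le_max_left _ _))] at h
  have hρ : completionTime q a v l ≤ ρ := min_eq_right_iff.1 h.symm
  unfold serviceBefore
  split_ifs with hb
  · simp
  · rw [completionTime_eq_serviceStart_add] at hρ
    rw [tsub_eq_zero_of_le (ENNReal.le_sub_of_add_le_left hb hρ), ENNReal.toReal_zero]

theorem completionTime_eq_max_add (hv : ∀ l, 0 < v l) {l : ℕ} {S ρ : ℝ≥0∞}
    (h : min (max S (prevCompletion q a v l)) (completionTime q a v l) =
      min ρ (completionTime q a v l)) (hS : S < completionTime q a v l)
    (hb : serviceStart q a v l ≠ ∞) :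
    completionTime q a v l = max (serviceStart q a v l) S + ENNReal.ofReal
      (ENNReal.ofReal (v l) - serviceBefore (serviceStart q a v l) ρ).toReal := by
  have hC := completionTime_eq_serviceStart_add (q := q) (a := a) (v := v) l
  have hp : prevCompletion q a v l ≤ serviceStart q a v l := le_max_right _ _
  have hbC : serviceStart q a v l < completionTime q a v l := by
    rw [hC]; exact ENNReal.lt_add_right hb (by simpa using hv l)
  rw [min_eq_left (max_lt hS (hp.trans_lt hbC)).le] at h
  have hρ : ρ = max S (prevCompletion q a v l) := by
    rcases min_choice ρ (completionTime q a v l) with h1 | h1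
    · rw [h1] at h; exact h.symm
    · rw [h1] at h; exact absurd h (max_lt hS (hp.trans_lt hbC)).ne
  rw [ENNReal.ofReal_toReal (ne_top_of_le_ne_top ENNReal.ofReal_ne_top tsub_le_self),
    serviceBefore, if_neg hb, hρ]
  rcases le_total S (serviceStart q a v l) with h1 | h1
  · rw [tsub_eq_zero_of_le (max_le h1 hp), tsub_zero, max_eq_left h1, hC]
  · rw [max_eq_left (hp.trans h1), max_eq_right h1]
    obtain ⟨e, rfl⟩ := exists_add_of_le h1
    rw [ENNReal.add_sub_cancel_left hb, add_assoc, add_tsub_cancel_of_le, hC]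
    rw [hC] at hS
    exact (lt_of_add_lt_add_left hS).le

end Residual

theorem ae_expMeasure_pos {r : ℝ} (hr : 0 < r) : ∀ᵐ v ∂(expMeasure r), 0 < v := by
  have hp := isProbabilityMeasure_expMeasure hr
  have h := measureReal_expMeasure_Iic hr le_rfl
  rw [mul_zero, neg_zero, Real.exp_zero, sub_self, measureReal_eq_zero_iff] at h
  rw [ae_iff]
  simpa [Iic] using h

/-! ### The lower bound on the mean time between messages -/

section Main

variable {Ω : Type*} {mΩ : MeasurableSpace Ω} {P : Measure Ω} {𝓕 : ℕ → MeasurableSpace Ω}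
  {q : Ω → ℕ} {A : ℝ≥0 → Ω → ℕ} {V : ℕ → Ω → ℝ} {r : ℝ} {x : ℕ}

theorem IsCausal.exists_residual (H : IsCausal P 𝓕 q A V) {S : Ω → ℝ≥0∞}
    (hS : ∀ t : ℝ≥0, MeasurableSet[history P 𝓕 q A V t] {ω | S ω ≤ t}) :
    ∃ α : ℕ → Ω → ℝ≥0∞, (∀ l, Measurable[𝓕 l] (α l)) ∧ ∀ᵐ ω ∂P,
      (S ω = ∞ → ∀ l, (ENNReal.ofReal (V l ω) - α l ω).toReal = 0) ∧
      ∀ s : ℝ≥0, S ω = s → IsResidual (q ω) (fun t => A t ω) (fun l => V l ω) s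
        fun l => (ENNReal.ofReal (V l ω) - α l ω).toReal := by
  choose c hc hc' using H.exists_prevCompletion
  choose b hb hb' using fun l => H.exists_serviceStart (hc l) (hc' l)
  choose ρ hρ hρ' using fun l => H.exists_predictable (hc l) (hc' l) (R := S) fun t => hS t l
  refine ⟨fun l ω => serviceBefore (b l ω) (ρ l ω), fun l => ?_, ?_⟩
  · exact Measurable.ite (hb l (measurableSet_singleton ∞)) measurable_const
      ((hρ l).sub (hb l))
  filter_upwards [ae_all_iff.2 hb', ae_all_iff.2 hρ', H.pos] with ω hbω hρω hv
  simp only [← hbω]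
  refine ⟨fun hSω l => residual_eq_zero (hρω l) (hSω ▸ le_top), fun s hs => ⟨fun l =>
    ENNReal.toReal_nonneg, fun l hl => residual_eq_zero (hρω l) ?_, fun l hl hB => ?_⟩⟩
  · rw [hs]
    exact (lt_departures_iff (H.path ω)).1 hl
  · rw [← hs]
    refine completionTime_eq_max_add hv (hρω l) ?_ hB
    rw [hs, ← not_le, ← lt_departures_iff (H.path ω)]
    omega

theorem IsCausal.nullMeasurableSet_lt_top (H : IsCausal P 𝓕 q A V) {S : Ω → ℝ≥0∞}
    (hS : ∀ t : ℝ≥0, MeasurableSet[history P 𝓕 q A V t] {ω | S ω ≤ t}) :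
    NullMeasurableSet {ω | S ω < ∞} P := by
  have h : {ω | S ω < ∞} = ⋃ n : ℕ, {ω | S ω ≤ (n : ℝ≥0)} := by
    ext ω
    simp only [mem_ofPred_eq, mem_iUnion]
    constructor
    · intro h
      obtain ⟨n, hn⟩ := ENNReal.exists_nat_gt h.ne
      exact ⟨n, by simpa using hn.le⟩
    · rintro ⟨n, hn⟩
      exact hn.trans_lt ENNReal.coe_lt_top
  rw [h]
  exact NullMeasurableSet.iUnion fun n => H.nullMeasurableSet (hS n)

theorem IsCausal.le_lintegral_messageTime_sub [IsProbabilityMeasure P] (H : IsCausal P 𝓕 q A V)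
    (hr : 0 < r) (hx : 3 ≤ x) (hlaw : ∀ l, HasLaw (V l) (expMeasure r) P)
    (hind : ∀ l, Indep (𝓕 l) (MeasurableSpace.comap (V l) inferInstance) P)
    {T : ℕ → Ω → ℝ≥0∞}
    (hT : ∀ m ω, T m ω = messageTime x r (q ω) (fun s => A s ω) (fun l => V l ω) m) (m : ℕ) :
    ENNReal.ofReal (((x : ℝ) / 2 - 1) ^ 2 / r) * P {ω | T m ω < ∞} ≤
      ∫⁻ ω in {ω | T m ω < ∞}, (T (m + 1) ω - T m ω) ∂P := by
  set lam : ℝ := (x : ℝ) / 2 - 1 with hlam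
  have hlam0 : 0 < lam := by
    have : (3 : ℝ) ≤ x := by exact_mod_cast hx
    linarith
  have hT_le : ∀ m, ∀ t : ℝ≥0, MeasurableSet[history P 𝓕 q A V t] {ω | T m ω ≤ t} := by
    intro m t
    simp only [hT]
    exact H.measurableSet_messageTime_le hr m t
  have hSm := H.nullMeasurableSet_lt_top (hT_le m)
  have hTm := H.nullMeasurableSet_lt_top (hT_le (m + 1))
  have hST : ∀ ω, T m ω ≤ T (m + 1) ω := fun ω => by
    rw [hT, hT]; exact messageTime_le_succ m
  set I := ∫⁻ ω in {ω | T m ω < ∞}, (T (m + 1) ω - T m ω) ∂P with hI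
  rw [← lintegral_indicator₀ hSm] at hI
  -- If the next message fails to come with positive probability, the duration has infinite mean.
  -- Otherwise both message events have the same probability.
  by_cases hZ : P ({ω | T m ω < ∞} \ {ω | T (m + 1) ω < ∞}) = 0
  swap
  · have : I = ∞ := by
      refine top_unique ?_
      calc (∞ : ℝ≥0∞) = ∞ * P ({ω | T m ω < ∞} \ {ω | T (m + 1) ω < ∞}) :=
            (ENNReal.top_mul hZ).symm
        _ = ∫⁻ ω, ({ω | T m ω < ∞} \ {ω | T (m + 1) ω < ∞}).indicator (fun _ => ∞) ω ∂P :=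
            (lintegral_indicator_const₀ (hSm.diff hTm) _).symm
        _ ≤ I := by
          rw [hI]
          refine lintegral_mono fun ω => ?_
          by_cases hω : ω ∈ {ω | T m ω < ∞} \ {ω | T (m + 1) ω < ∞}
          · have h1 : T (m + 1) ω = ∞ := not_lt_top_iff.1 hω.2
            rw [indicator_of_mem hω, indicator_of_mem hω.1, h1,
              ENNReal.top_sub (show T m ω < ∞ from hω.1).ne]
          · rw [indicator_of_notMem hω]
            exact zero_le
    rw [this]
    exact le_top
  obtain ⟨α, hα, hres⟩ := H.exists_residual (hT_le m)
  set W : ℕ → Ω → ℝ := fun l ω => (ENNReal.ofReal (V l ω) - α l ω).toReal with hW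
  have hmom := lintegral_stoppedWalk_sq H.mono H.le H.measurable_requirement hlam0 hr hlaw hind
    hα (W := W) (fun _ _ => rfl)
  set D : Ω → ℕ := fun ω =>
    departures (q ω) (fun s => A s ω) (fun l => V l ω) (T (m + 1) ω).toNNReal with hD
  have hpath : ∀ᵐ ω ∂P, (∀ n, ∑ l ∈ Finset.range n, ENNReal.ofReal
        (walkWork lam r (stoppedWalk lam r (fun l => W l ω) l) (W l ω)) ≤
        {ω | T m ω < ∞}.indicator (fun ω => T (m + 1) ω - T m ω) ω) ∧
      ∀ n, T (m + 1) ω < ∞ → D ω < n → lam ≤ |stoppedWalk lam r (fun l => W l ω) n| := by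
    filter_upwards [hres, H.pos] with ω hω hv
    rcases eq_or_ne (T m ω) ∞ with h1 | h1
    · have hW0 : ∀ l, W l ω = 0 := hω.1 h1
      refine ⟨fun n => ?_, fun n h2 => absurd ((hST ω).trans_lt h2) (by simp [h1])⟩
      rw [Finset.sum_eq_zero fun l _ => ?_]
      · exact zero_le
      · rw [hW0, ENNReal.ofReal_of_nonpos (walkWork_le le_rfl)]
    obtain ⟨s, hs⟩ := exists_coe_eq_of_ne_top h1
    rcases eq_or_ne (T (m + 1) ω) ∞ with h2 | h2
    · refine ⟨fun n => ?_, fun n h3 => absurd h2 h3.ne⟩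
      rw [indicator_of_mem (show ω ∈ {ω | T m ω < ∞} from h1.lt_top), h2, ENNReal.top_sub h1]
      exact le_top
    obtain ⟨t, ht⟩ := exists_coe_eq_of_ne_top h2
    obtain ⟨hst, herr⟩ := emulationError_messageTime (H.path ω) (hs.trans (hT m ω)).symm
      (ht.trans (hT (m + 1) ω)).symm
    have hR := hω.2 s hs.symm
    refine ⟨fun n => ?_, fun n _ hn => ?_⟩
    · rw [indicator_of_mem (show ω ∈ {ω | T m ω < ∞} from h1.lt_top), ← hs, ← ht]
      exact hR.sum_walkWork_le (H.path ω) hr hv hx hst herr hlam n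
    · have hb := (hR.stoppedWalk_bounds (H.path ω) hr hv hx hst herr hlam).1
      simp only [hD, ← ht, ENNReal.toNNReal_coe] at hn
      rw [stoppedWalk_eq_of_le hn hb]
      exact hb
  -- Markov's inequality for the squared walk after `n` jobs. The truncation `D ω < n` guarantees
  -- that the walk has stopped by then, and no integrability of the duration is needed.
  have hbound : ∀ n, ENNReal.ofReal (lam ^ 2) * P {ω | T (m + 1) ω < ∞ ∧ D ω < n} ≤
      ENNReal.ofReal r * I := by
    intro n
    have hym : Measurable fun ω => ENNReal.ofReal (stoppedWalk lam r (fun l => W l ω) n ^ 2) :=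
      ENNReal.measurable_ofReal.comp (((measurable_stoppedWalk H.mono (measurable_residual H.mono
        H.measurable_requirement hα fun _ _ => rfl) n).mono (H.le _) le_rfl).pow_const 2)
    calc ENNReal.ofReal (lam ^ 2) * P {ω | T (m + 1) ω < ∞ ∧ D ω < n}
        ≤ ENNReal.ofReal (lam ^ 2) * P {ω | ENNReal.ofReal (lam ^ 2) ≤
            ENNReal.ofReal (stoppedWalk lam r (fun l => W l ω) n ^ 2)} := by
          gcongr 1
          refine measure_mono_ae ?_
          filter_upwards [hpath] with ω hω hn
          refine ENNReal.ofReal_le_ofReal ?_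
          rw [← sq_abs (stoppedWalk _ _ _ _)]
          exact pow_le_pow_left₀ hlam0.le (hω.2 n hn.1 hn.2) 2
      _ ≤ ∫⁻ ω, ENNReal.ofReal (stoppedWalk lam r (fun l => W l ω) n ^ 2) ∂P :=
          mul_meas_ge_le_lintegral hym _
      _ ≤ ENNReal.ofReal r * I := by
          rw [hmom n, hI]
          gcongr 1
          refine lintegral_mono_ae ?_
          filter_upwards [hpath] with ω hω
          exact hω.1 n
  have hunion : {ω | T (m + 1) ω < ∞} = ⋃ n, {ω | T (m + 1) ω < ∞ ∧ D ω < n} := by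
    ext ω
    simp only [mem_ofPred_eq, mem_iUnion]
    exact ⟨fun h => ⟨D ω + 1, h, Nat.lt_succ_self _⟩, fun ⟨_, h, _⟩ => h⟩
  have hmono : Monotone fun n => {ω | T (m + 1) ω < ∞ ∧ D ω < n} :=
    fun k n hkn ω hω => ⟨hω.1, hω.2.trans_le hkn⟩
  have hfin : ENNReal.ofReal (lam ^ 2) * P {ω | T (m + 1) ω < ∞} ≤ ENNReal.ofReal r * I := by
    -- Continuity from below holds for arbitrary increasing sets, so `D` need not be measurable.
    rw [hunion, hmono.measure_iUnion, ENNReal.mul_iSup]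
    exact iSup_le hbound
  have hle : P {ω | T m ω < ∞} ≤ P {ω | T (m + 1) ω < ∞} := by
    calc P {ω | T m ω < ∞}
        ≤ P ({ω | T (m + 1) ω < ∞} ∪ ({ω | T m ω < ∞} \ {ω | T (m + 1) ω < ∞})) :=
          measure_mono (by rw [union_sdiff_self]; exact subset_union_right)
      _ ≤ P {ω | T (m + 1) ω < ∞} := (measure_union_le _ _).trans (by rw [hZ, add_zero])
  rw [ENNReal.ofReal_div_of_pos hr, ENNReal.div_eq_inv_mul, mul_assoc]
  calc (ENNReal.ofReal r)⁻¹ * (ENNReal.ofReal (lam ^ 2) * P {ω | T m ω < ∞})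
      ≤ (ENNReal.ofReal r)⁻¹ * (ENNReal.ofReal r * I) := by
        gcongr 1
        exact le_trans (by gcongr) hfin
    _ = I := by
        rw [← mul_assoc, ENNReal.inv_mul_cancel (by simpa using hr) ENNReal.ofReal_ne_top, one_mul]

end Main

end CARE

end

theorem theorem2p2 {Ω : Type*} (𝓔 : MeasurableSpace Ω) {mΩ : MeasurableSpace Ω}
    (P : Measure Ω) [IsProbabilityMeasure P]
    {K : ℕ} (i : Fin K) (x : ℕ) (hx : 3 ≤ x)
    -- service rates, initial queue lengths, arrival processes, service time requirements
    (μ : Fin K → ℝ) (hμ : ∀ j, 0 < μ j)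
    (q : Fin K → Ω → ℕ) (A : Fin K → ℝ≥0 → Ω → ℕ) (V : Fin K → ℕ → Ω → ℝ)
    (hA : ∀ j ω, CARE.IsCountingPath fun t => A j t ω)
    (hA_meas : ∀ j t, Measurable (A j t))
    (hV_meas : ∀ j l, Measurable (V j l))
    -- the other servers: an arbitrary service law, without jobs of requirement zero
    (hV_pos : ∀ j, j ≠ i → ∀ᵐ ω ∂P, ∀ l, 0 < V j l ω)
    -- server `i`: i.i.d. exponential requirements
    (hV_law : ∀ l, HasLaw (V i l) (expMeasure (μ i)) P)
    (hV_indep : iIndepFun (V i) P)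
    -- arbitrary, but causal, arrivals to server `i`; `𝓔` is the exogenous information
    (h𝓔 : 𝓔 ≤ mΩ)
    (h𝓔_indep : Indep 𝓔 (⨆ l, MeasurableSpace.comap (V i l) inferInstance) P)
    (hq : Measurable[𝓔] (q i))
    (hcausal : CARE.NonAnticipating P 𝓔 (q i) (A i) (V i)) :
    (∀ᵐ ω ∂P, ∀ t : ℝ≥0,
      CARE.approxQuality x μ (fun j => q j ω) (fun j s => A j s ω) (fun j l => V j l ω) t
        ≤ x - 1) ∧
    ∀ (T : ℕ → Ω → ℝ≥0∞),
      (∀ m ω, T m ω =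
        CARE.messageTime x (μ i) (q i ω) (fun s => A i s ω) (fun l => V i l ω) m) →
      ∀ m : ℕ, P {ω | T m ω < ∞} ≠ 0 →
        ENNReal.ofReal (((x : ℝ) / 2 - 1) ^ 2 / μ i) ≤
          ∫⁻ ω, (T (m + 1) ω - T m ω) ∂(ProbabilityTheory.cond P {ω | T m ω < ∞}) := by
  have hpos_i : ∀ᵐ ω ∂P, ∀ l, 0 < V i l ω := ae_all_iff.2 fun l =>
    ((hV_law l).ae_iff (p := fun v => 0 < v) (measurableSet_setOfPred.1 measurableSet_Ioi)).2
      (CARE.ae_expMeasure_pos (hμ i))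
  have hpos : ∀ j, ∀ᵐ ω ∂P, ∀ l, 0 < V j l ω := fun j => by
    rcases eq_or_ne j i with rfl | hj
    exacts [hpos_i, hV_pos j hj]
  have H : CARE.IsCausal P (CARE.infoUpTo 𝓔 (V i)) (q i) (A i) (V i) :=
    { mono := CARE.infoUpTo_mono 𝓔 (V i)
      le := CARE.infoUpTo_le h𝓔 (hV_meas i)
      path := hA i
      measurable_init := hq.mono le_sup_left le_rfl
      measurable_requirement := CARE.measurable_infoUpTo 𝓔 (V i)
      pos := hpos_i
      arrivals := hcausal }
  refine ⟨?_, fun T hT m hm => ?_⟩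
  · filter_upwards [ae_all_iff.2 hpos] with ω hω t
    refine Finset.sup_le fun j _ => ?_
    have := CARE.approxError_lt (q := q j ω) (hA j ω) (hμ j) (hω j) (show 1 ≤ x by omega) t
    exact Nat.le_sub_one_of_lt this
  · have h := H.le_lintegral_messageTime_sub (hμ i) hx hV_law
      (CARE.indep_infoUpTo h𝓔 (hV_meas i) hV_indep h𝓔_indep) hT m
    rw [ProbabilityTheory.cond, lintegral_smul_measure, smul_eq_mul, mul_comm,
      ← div_eq_mul_inv, ENNReal.le_div_iff_mul_le (.inl hm) (.inl (measure_ne_top _ _))]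
    exact h
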